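/- Let $d\ge 0$, let $D$ be a probability distribution on $\mathbb Z^d$, and let $p=(p_m)_{m\ge 0}$ be a probability distribution on $\{0,1,2,\dots\}$ (the offspring distribution) that is critical, $\sum_m m\,p_m=1$, has a finite third moment, $\sum_m m^3p_m<\infty$, and satisfies $\sigma_p^2:=\sum_m m(m-1)p_m>0$. Let $\mathbb P$ be the law of the branching random walk $(T,\phi)$ on $\mathbb Z^d$ with offspring distribution $p$ and step distribution $D$: $T$ is the (ordered) family tree of the Galton--Watson process with offspring distribution $p$, started from one individual, and $\phi$ maps the vertices of $T$ to $\mathbb Z^d$ in such a way that the root is sent to the origin and the displacements $\phi(j)-\phi(i)$, for $j$ a child of $i$, are independent of $T$ and independent of each other with law $D$. Write $|i|$ for the generation of $i\in T$, $(T,\phi)_m$ for the restriction of $(T,\phi)$ to the generations $0,\dots,m$, and $N_m=\#\{i\in T:|i|=m\}$. The space of embedded locally finite trees carries the $\sigma$-algebra generated by the cylinder events $\{(T,\phi)_m=C\}$. For each such event let $$\mathbb P_n((T,\phi)_m=C)=\sum_{x\in\mathbb Z^d}\sum_{|i|=n}\mathbb P\big(i\in T,\ (T,\phi)_m=C,\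 \phi(i)=x\big)=\mathbb E\big[N_n\mathbf 1\{(T,\phi)_m=C\}\big].$$ Then there is exactly one probability measure $\mathbb P_\infty$ on the space of embedded trees (the incipient infinite branching random walk measure, IIBRW) such that $\mathbb P_\infty((T,\phi)_m=C)=\lim_{n\to\infty}\mathbb P_n((T,\phi)_m=C)$ for all $m$ and $C$. Under $\mathbb P_\infty$, as $m\to\infty$, $N_m/m$ converges weakly to a size-biased exponential random variable with parameter $\lambda=2/\sigma_p^2$, that is, to the probability distribution on $[0,\infty)$ with density $\lambda^2xe^{-\lambda x}$. -/

import Mathlib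

open MeasureTheory ProbabilityTheory Filter Topology
open scoped ENNReal

/-- The lattice `ℤ^d`. -/
abbrev ZdPoint (d : ℕ) : Type := Fin d → ℤ

/-- An embedded tree `(T, φ)`: a (possibly infinite) locally finite family tree `T`, given as a
set of words, with a map `φ` from its vertices to `ℤ^d` that sends the root to the origin.
A vertex is the word of the birth ranks on its line of descent, the most recent one first:
the root is `[]`, the children of `w` are `0 :: w, 1 :: w, 2 :: w, …`, and the generation of `w`
is `w.length`. The map `φ` is set to `0` off `T`, so that two embedded trees are equal
exactly if they have the same vertices, at the same places. -/
@[ext]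
structure EmbTree (d : ℕ) where
  verts : Set (List ℕ)
  pos : List ℕ → ZdPoint d
  root_mem : [] ∈ verts
  parent_mem : ∀ (j : ℕ) (w : List ℕ), j :: w ∈ verts → w ∈ verts
  sibling_mem : ∀ (j k : ℕ) (w : List ℕ), k ≤ j → j :: w ∈ verts → k :: w ∈ verts
  finite_children : ∀ w : List ℕ, {j : ℕ | j :: w ∈ verts}.Finite
  pos_root : pos [] = 0
  pos_off : ∀ w : List ℕ, w ∉ verts → pos w = 0

namespace EmbTree

variable {d : ℕ}

open Classical in
/-- `(T, φ)_m`: the restriction of an embedded tree to the generations `0, …, m`. -/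
noncomputable def trunc (m : ℕ) (T : EmbTree d) : EmbTree d where
  verts := {w | w ∈ T.verts ∧ w.length ≤ m}
  pos w := if w.length ≤ m then T.pos w else 0
  root_mem := ⟨T.root_mem, Nat.zero_le m⟩
  parent_mem j w h :=
    ⟨T.parent_mem j w h.1, le_trans (by simp) h.2⟩
  sibling_mem j k w hk h := ⟨T.sibling_mem j k w hk h.1, h.2⟩
  finite_children w := (T.finite_children w).subset fun _ h => h.1
  pos_root := by simp [T.pos_root]
  pos_off w hw := by
    by_cases hl : w.length ≤ m
    · rw [if_pos hl]
      exact T.pos_off w fun h => hw ⟨h, hl⟩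
    · rw [if_neg hl]

/-- The cylinder event `{(T, φ)_m = C}`. -/
def cylinder (m : ℕ) (C : EmbTree d) : Set (EmbTree d) := {T | T.trunc m = C}

/-- The `σ`-algebra generated by the cylinder events. -/
instance : MeasurableSpace (EmbTree d) :=
  MeasurableSpace.generateFrom {S | ∃ (m : ℕ) (C : EmbTree d), S = cylinder m C}

/-- `N_m`, the number of vertices in generation `m`. -/
noncomputable def N (m : ℕ) (T : EmbTree d) : ℕ := {w | w ∈ T.verts ∧ w.length = m}.ncard

end EmbTree

/-- The family tree in which the individual `w`, if it is ever born, has `ξ w` children. -/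
def born (ξ : List ℕ → ℕ) : List ℕ → Prop
  | [] => True
  | j :: w => born ξ w ∧ j < ξ w

/-- The place of `w`, if `w` is displaced from its parent by `Δ w`. -/
def place {d : ℕ} (Δ : List ℕ → ZdPoint d) : List ℕ → ZdPoint d
  | [] => 0
  | j :: w => place Δ w + Δ (j :: w)

open Classical in
/-- The embedded tree with family sizes `(η w).1` and displacements `(η w).2`. -/
noncomputable def embTreeOf {d : ℕ} (η : List ℕ → ℕ × ZdPoint d) : EmbTree d where
  verts := {w | born (fun v => (η v).1) w}
  pos w := if born (fun v => (η v).1) w then place (fun v => (η v).2) w else 0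
  root_mem := trivial
  parent_mem _ _ h := h.1
  sibling_mem _ _ _ hk h := ⟨h.1, lt_of_le_of_lt hk h.2⟩
  finite_children w := (Set.finite_lt_nat (η w).1).subset fun _ h => h.2
  pos_root := by simp [place]
  pos_off w hw := if_neg hw

theorem measurableSet_born {d : ℕ} (w : List ℕ) :
    MeasurableSet {η : List ℕ → ℕ × ZdPoint d | born (fun v => (η v).1) w} := by
  induction w with
  | nil => simp [born]
  | cons j w ih =>
    refine ih.inter ?_
    have h : Measurable fun η : List ℕ → ℕ × ZdPoint d => (η w).1 :=
      measurable_fst.comp (measurable_pi_apply w)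
    exact h (measurableSet_Ioi (a := j))

theorem measurable_place {d : ℕ} (w : List ℕ) :
    Measurable fun η : List ℕ → ℕ × ZdPoint d => place (fun v => (η v).2) w := by
  induction w with
  | nil => exact measurable_const
  | cons j w ih => exact ih.add (measurable_snd.comp (measurable_pi_apply (j :: w)))

theorem measurable_embTreeOf {d : ℕ} :
    Measurable (embTreeOf : (List ℕ → ℕ × ZdPoint d) → EmbTree d) := by
  classical
  refine measurable_generateFrom ?_
  rintro _ ⟨m, C, rfl⟩
  have key : embTreeOf ⁻¹' EmbTree.cylinder m C =
      ⋂ w : List ℕ, ({η : List ℕ → ℕ × ZdPoint d |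
          (born (fun v => (η v).1) w ∧ w.length ≤ m) ↔ w ∈ C.verts} ∩
        {η | (if w.length ≤ m then
          if born (fun v => (η v).1) w then place (fun v => (η v).2) w else 0 else 0)
            = C.pos w}) := by
    ext η
    simp only [Set.mem_preimage, EmbTree.cylinder, Set.mem_ofPred_eq, EmbTree.ext_iff,
      Set.mem_iInter, Set.mem_inter_iff, Set.ext_iff, funext_iff (f := (EmbTree.trunc _ _).pos)]
    exact ⟨fun h w => ⟨h.1 w, h.2 w⟩, fun h => ⟨fun w => (h w).1, fun w => (h w).2⟩⟩
  rw [key]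
  refine MeasurableSet.iInter fun w => MeasurableSet.inter ?_ ?_
  · exact MeasurableSet.iff ((measurableSet_born w).inter (MeasurableSet.const _))
      (MeasurableSet.const _)
  · have h : Measurable fun η : List ℕ → ℕ × ZdPoint d => (if w.length ≤ m then
          if born (fun v => (η v).1) w then place (fun v => (η v).2) w else 0 else 0) := by
      split_ifs
      · exact Measurable.ite (measurableSet_born w) (measurable_place w) measurable_const
      · exact measurable_const
    exact h (measurableSet_singleton (C.pos w))

/-- The law of branching random walk with offspring distribution `p` and step distribution `D`,
started from one particle at the origin: the numbers of children are independent with law `p`,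
and the displacements from parent to child are independent with law `D`. -/
noncomputable def brw {d : ℕ} (p : PMF ℕ) (D : PMF (ZdPoint d)) : Measure (EmbTree d) :=
  (Measure.infinitePi fun _ : List ℕ => p.toMeasure.prod D.toMeasure).map embTreeOf

/-- `P_n(C) = ∑_x ∑_{|i| = n} P(i ∈ T, (T, φ)_m = C, φ(i) = x)`. -/
noncomputable def brwTilted {d : ℕ} (p : PMF ℕ) (D : PMF (ZdPoint d)) (n m : ℕ) (C : EmbTree d) :
    ℝ≥0∞ :=
  ∑' (x : ZdPoint d) (i : {i : List ℕ // i.length = n}),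
    brw p D {T | i.1 ∈ T.verts ∧ T ∈ EmbTree.cylinder m C ∧ T.pos i.1 = x}

/-- `P` is the incipient infinite branching random walk measure:
`P((T, φ)_m = C) = lim_{n → ∞} P_n(C)` for every cylinder event. -/
def IsIIBRW {d : ℕ} (p : PMF ℕ) (D : PMF (ZdPoint d)) (P : ProbabilityMeasure (EmbTree d)) : Prop :=
  ∀ (m : ℕ) (C : EmbTree d),
    Tendsto (fun n : ℕ => brwTilted p D n m C) atTop
      (𝓝 ((P : Measure (EmbTree d)) (EmbTree.cylinder m C)))

/-- `σ_p² = ∑_m m (m - 1) p_m`. -/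
noncomputable def offspringVar (p : PMF ℕ) : ℝ :=
  ∑' m : ℕ, (m : ℝ) * ((m : ℝ) - 1) * (p m).toReal

/-- The density `a² x e^{-a x}`, `x ≥ 0`, of the size-biased exponential distribution. -/
noncomputable def sizeBiasedExpDensity (a x : ℝ) : ℝ :=
  if 0 ≤ x then a ^ 2 * x * Real.exp (-(a * x)) else 0

theorem withDensity_sizeBiasedExp_eq (a : ℝ) :
    (volume : Measure ℝ).withDensity (fun x => ENNReal.ofReal (sizeBiasedExpDensity a x)) =
      gammaMeasure 2 a := by
  unfold gammaMeasure
  congr 1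
  funext x
  unfold gammaPDF gammaPDFReal sizeBiasedExpDensity
  norm_num [Real.Gamma_two]

/-- The law of the size-biased exponential random variable with parameter `a > 0`. -/
noncomputable def sizeBiasedExp (a : ℝ) (ha : 0 < a) : ProbabilityMeasure ℝ :=
  ⟨(volume : Measure ℝ).withDensity (fun x => ENNReal.ofReal (sizeBiasedExpDensity a x)), by
    rw [withDensity_sizeBiasedExp_eq]
    exact isProbabilityMeasure_gammaMeasure two_pos ha⟩

/-!
The incipient infinite branching random walk is constructed as a tree with a spine. Each potential
vertex `v` independently carries a family size with law `p`, a displacement with law `D`, and a pair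
`(a, b)` with law `p (a + b + 1)`; criticality says exactly that the latter is a probability. The
spine descends from the root, passing from a vertex with pair `(a, b)` to its child of rank `a`, and
the vertices of the spine have `a + b + 1` children, while the others have the family sizes with
law `p`. Fix a finite tree `C` of height `m` and a vertex `i` in generation `m` of `C`. The event
that the spine runs through `i` and that the first `m` generations are those of `C` constrains
the mark at each vertex of `C` separately, and each constraint has the probability that it has in
the ordinary branching random walk (`setIntegral_spineMarksAt`, `setIntegral_spineCylinder`). Summed
over `i` this gives `P∞((T, φ)_m = C) = N_m(C) P((T, φ)_m = C)` (`iibrw_cylinder`), and summed over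
the trees of height `n ≥ m` that extend `C`, it gives `P_n((T, φ)_m = C) = P∞((T, φ)_m = C)`
(`brwTilted_eq_iibrw`): the sequence in the definition is constant from `n = m` on. Uniqueness holds
because the cylinder events form a `π`-system.

For the limit law, let `f(s) = ∑ p_k s^k`. The same product formula, with generating functions at
generation `m` in place of probabilities, gives the recursion
`E∞[s^(N_{m+1} - 1)] = f'(s) E∞[f(s)^(N_m - 1)]`, whence
`E∞[s^(N_m - 1)] = ∏_{k < m} f'(f^k(s))` with iterates `f^k` (`levelPgf_eq_prod`); the factor `f'`
is `siblingPgf`. With `b = σ_p² / 2` the third moment gives, for `u = s - 1` and `|s| ≤ 1`,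
`f(s) - 1 = u + b u² + O(u³)` and `f'(s) = 1 + 2 b u + O(u²)`. So if `u_k = f^k(s) - 1`, then
`1 / u_{k+1} = 1 / u_k - b + O(u_k)` and `f'(f^k(s)) = (u_{k+1} / u_k)² (1 + O(u_k²))`, and the
product telescopes to `(u_m / u_0)²` up to a factor near `1`. At `s = exp(iθ / m)`, all `u_k` are
`O(1 / m)`, so that `u_0 / u_m → 1 - iθb` and the product tends to `(1 - iθb)⁻²`
(`tendsto_prod_parabolic`). This is the characteristic function of the size-biased exponential law
with parameter `1 / b`, and Lévy's continuity theorem concludes.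
-/

/-! ### Embedded trees of finite height -/

namespace EmbTree

variable {d : ℕ}

theorem mem_verts_trunc {m : ℕ} {T : EmbTree d} {w : List ℕ} :
    w ∈ (T.trunc m).verts ↔ w ∈ T.verts ∧ w.length ≤ m := Iff.rfl

theorem pos_trunc_of_le {m : ℕ} {T : EmbTree d} {w : List ℕ} (h : w.length ≤ m) :
    (T.trunc m).pos w = T.pos w := if_pos h

theorem trunc_trunc {m n : ℕ} (h : m ≤ n) (T : EmbTree d) :
    (T.trunc n).trunc m = T.trunc m := by
  refine EmbTree.ext ?_ ?_
  · ext w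
    simp only [mem_verts_trunc]
    constructor
    · rintro ⟨⟨h1, -⟩, h3⟩
      exact ⟨h1, h3⟩
    · rintro ⟨h1, h3⟩
      exact ⟨⟨h1, h3.trans h⟩, h3⟩
  · funext w
    by_cases hw : w.length ≤ m
    · rw [pos_trunc_of_le hw, pos_trunc_of_le hw, pos_trunc_of_le (hw.trans h)]
    · simp [trunc, hw]

theorem trunc_self (m : ℕ) (T : EmbTree d) : (T.trunc m).trunc m = T.trunc m :=
  trunc_trunc le_rfl T

theorem mem_verts_of_suffix {T : EmbTree d} {v w : List ℕ} (h : v <:+ w) (hw : w ∈ T.verts) :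
    v ∈ T.verts := by
  obtain ⟨u, rfl⟩ := h
  induction u with
  | nil => exact hw
  | cons j u ih => exact ih (T.parent_mem _ _ hw)

theorem length_le_of_mem {m : ℕ} {C : EmbTree d} (hC : C.trunc m = C) {w : List ℕ}
    (hw : w ∈ C.verts) : w.length ≤ m := by
  rw [← hC] at hw
  exact hw.2

theorem finite_level (T : EmbTree d) (m : ℕ) : {w | w ∈ T.verts ∧ w.length = m}.Finite := by
  induction m with
  | zero =>
    refine (Set.finite_singleton []).subset ?_
    rintro w ⟨-, hw⟩
    exact List.length_eq_zero_iff.1 hw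
  | succ m ih =>
    refine (ih.biUnion fun w _ => (T.finite_children w).image fun j => j :: w).subset ?_
    rintro w ⟨hw, hl⟩
    obtain _ | ⟨j, v⟩ := w
    · simp at hl
    · simp only [Set.mem_iUnion]
      exact ⟨v, ⟨T.parent_mem _ _ hw, by simpa using hl⟩, j, hw, rfl⟩

/-- The finitely many vertices in generation `m`. -/
noncomputable def level (T : EmbTree d) (m : ℕ) : Finset (List ℕ) := (T.finite_level m).toFinset

theorem mem_level {T : EmbTree d} {m : ℕ} {w : List ℕ} :
    w ∈ T.level m ↔ w ∈ T.verts ∧ w.length = m := by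
  simp [level]

theorem N_eq_card_level (m : ℕ) (T : EmbTree d) : T.N m = (T.level m).card :=
  Set.ncard_eq_toFinset_card _ _

theorem level_trunc {m n : ℕ} (h : m ≤ n) (T : EmbTree d) :
    (T.trunc n).level m = T.level m := by
  ext w
  simp only [mem_level, mem_verts_trunc]
  constructor
  · rintro ⟨⟨h1, -⟩, h3⟩
    exact ⟨h1, h3⟩
  · rintro ⟨h1, h3⟩
    exact ⟨⟨h1, h3.le.trans h⟩, h3⟩

theorem N_trunc {m n : ℕ} (h : m ≤ n) (T : EmbTree d) : (T.trunc n).N m = T.N m := by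
  rw [N_eq_card_level, N_eq_card_level, level_trunc h]

theorem finite_verts {m : ℕ} {C : EmbTree d} (hC : C.trunc m = C) : C.verts.Finite := by
  refine ((Set.finite_Iic m).biUnion fun n _ => C.finite_level n).subset ?_
  intro w hw
  simp only [Set.mem_iUnion]
  exact ⟨w.length, length_le_of_mem hC hw, hw, rfl⟩

/-- There are only countably many embedded trees of height at most `m`, since such a tree is
determined by the finite set of its vertices and their places. -/
instance countable_truncated (m : ℕ) : Countable {C : EmbTree d // C.trunc m = C} := by
  classical
  let F : {C : EmbTree d // C.trunc m = C} → Finset (List ℕ × ZdPoint d) := fun C =>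
    (finite_verts C.2).toFinset.image fun w => (w, C.1.pos w)
  refine Function.Injective.countable (f := F) ?_
  intro C C' h
  have key : ∀ w x, (w ∈ C.1.verts ∧ C.1.pos w = x) ↔ (w ∈ C'.1.verts ∧ C'.1.pos w = x) := by
    intro w x
    have := Finset.ext_iff.1 h (w, x)
    simpa [F] using this
  refine Subtype.ext (EmbTree.ext ?_ ?_)
  · ext w
    exact ⟨fun hw => ((key w _).1 ⟨hw, rfl⟩).1, fun hw => ((key w _).2 ⟨hw, rfl⟩).1⟩
  · funext w
    by_cases hw : w ∈ C.1.verts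
    · exact ((key w _).1 ⟨hw, rfl⟩).2.symm
    · rw [C.1.pos_off w hw, C'.1.pos_off w fun hw' => hw ((key w _).2 ⟨hw', rfl⟩).1]

/-- The number of children of `w`. -/
noncomputable def numChildren (T : EmbTree d) (w : List ℕ) : ℕ := {j | j :: w ∈ T.verts}.ncard

theorem cons_mem_verts_iff {T : EmbTree d} {w : List ℕ} {j : ℕ} :
    j :: w ∈ T.verts ↔ j < T.numChildren w := by
  have hlow : IsLowerSet {j | j :: w ∈ T.verts} := fun a b hab ha => T.sibling_mem a b w hab ha
  obtain ⟨c, hc⟩ : ∃ c, {j | j :: w ∈ T.verts} = Set.Iio c := by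
    obtain h | ⟨c, hc⟩ := hlow.eq_univ_or_Iio
    · exact absurd (h ▸ T.finite_children w) Set.infinite_univ
    · exact ⟨c, hc⟩
  have hn : T.numChildren w = c := by
    rw [numChildren, hc, Set.ncard_eq_toFinset_card', Set.toFinset_Iio, Nat.card_Iio]
  rw [hn]
  exact Set.ext_iff.1 hc j

theorem level_zero (T : EmbTree d) : T.level 0 = {[]} := by
  ext w
  simp only [mem_level, Finset.mem_singleton, List.length_eq_zero_iff]
  constructor
  · exact fun h => h.2
  · rintro rfl
    exact ⟨T.root_mem, rfl⟩

theorem N_succ (T : EmbTree d) (m : ℕ) : T.N (m + 1) = ∑ v ∈ T.level m, T.numChildren v := by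
  have h : T.level (m + 1) =
      ((T.level m).sigma fun v => Finset.range (T.numChildren v)).image fun x => x.2 :: x.1 := by
    ext w
    simp only [mem_level, Finset.mem_image, Finset.mem_sigma, Finset.mem_range, Sigma.exists]
    constructor
    · rintro ⟨hw, hl⟩
      obtain _ | ⟨j, v⟩ := w
      · simp at hl
      · exact ⟨v, j, ⟨⟨T.parent_mem _ _ hw, by simpa using hl⟩, cons_mem_verts_iff.1 hw⟩, rfl⟩
    · rintro ⟨v, j, ⟨⟨hv, hl⟩, hj⟩, rfl⟩
      exact ⟨cons_mem_verts_iff.2 hj, by simp [hl]⟩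
  rw [N_eq_card_level, h, Finset.card_image_of_injective, Finset.card_sigma]
  · simp
  · rintro ⟨v, j⟩ ⟨v', j'⟩ h
    simp only [List.cons.injEq] at h
    obtain ⟨rfl, rfl⟩ := h
    rfl

theorem mem_cylinder {m : ℕ} {C T : EmbTree d} : T ∈ cylinder m C ↔ T.trunc m = C := Iff.rfl

theorem measurableSet_cylinder (m : ℕ) (C : EmbTree d) : MeasurableSet (cylinder m C) :=
  MeasurableSpace.measurableSet_generateFrom ⟨m, C, rfl⟩

theorem cylinder_subset {m n : ℕ} (h : m ≤ n) {C C' T : EmbTree d} (hT : T ∈ cylinder m C)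
    (hT' : T ∈ cylinder n C') : cylinder n C' ⊆ cylinder m C := by
  rw [mem_cylinder] at hT hT'
  intro S hS
  rw [mem_cylinder] at hS ⊢
  rw [← trunc_trunc h, hS, ← hT', trunc_trunc h, hT]

/-- The cylinder events form a `π`-system: two of them are disjoint or nested. -/
theorem isPiSystem_cylinder :
    IsPiSystem {S : Set (EmbTree d) | ∃ (m : ℕ) (C : EmbTree d), S = cylinder m C} := by
  rintro _ ⟨m, C, rfl⟩ _ ⟨n, C', rfl⟩ ⟨T, hT, hT'⟩
  rcases le_total m n with h | h
  · exact ⟨n, C', Set.inter_eq_right.2 (cylinder_subset h hT hT')⟩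
  · exact ⟨m, C, Set.inter_eq_left.2 (cylinder_subset h hT' hT)⟩

theorem measure_ext_of_cylinder {P Q : Measure (EmbTree d)} [IsProbabilityMeasure P]
    [IsProbabilityMeasure Q] (h : ∀ m C, P (cylinder m C) = Q (cylinder m C)) : P = Q := by
  refine ext_of_generate_finite _ rfl isPiSystem_cylinder ?_ (by simp)
  rintro _ ⟨m, C, rfl⟩
  exact h m C

/-- The restriction to the generations `0, …, m`, as a map into a countable type. -/
noncomputable def truncated (m : ℕ) (T : EmbTree d) : {C : EmbTree d // C.trunc m = C} :=
  ⟨T.trunc m, T.trunc_self m⟩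

theorem truncated_eq_iff {m : ℕ} {T : EmbTree d} {C : {C : EmbTree d // C.trunc m = C}} :
    T.truncated m = C ↔ T ∈ cylinder m C.1 := by
  rw [Subtype.ext_iff]
  exact Iff.rfl

theorem measurableSet_preimage_truncated (m : ℕ) (A : Set {C : EmbTree d // C.trunc m = C}) :
    MeasurableSet (truncated m ⁻¹' A) := by
  have : truncated m ⁻¹' A = ⋃ C ∈ A, cylinder m C.1 := by
    ext T
    simp only [Set.mem_preimage, Set.mem_iUnion, exists_prop]
    constructor
    · intro h
      exact ⟨_, h, rfl⟩
    · rintro ⟨C, hC, hT⟩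
      rwa [truncated_eq_iff.2 hT]
  rw [this]
  exact MeasurableSet.biUnion (Set.to_countable A) fun C _ => measurableSet_cylinder m C.1

theorem measurable_N (m : ℕ) : Measurable (N m : EmbTree d → ℕ) := by
  intro A _
  have : N m ⁻¹' A = truncated (d := d) m ⁻¹' ((fun C => C.1.N m) ⁻¹' A) := by
    ext T
    simp only [Set.mem_preimage, truncated, N_trunc le_rfl]
  rw [this]
  exact measurableSet_preimage_truncated m _

theorem measurableSet_mem_verts (i : List ℕ) : MeasurableSet {T : EmbTree d | i ∈ T.verts} := by
  have : {T : EmbTree d | i ∈ T.verts} =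
      truncated i.length ⁻¹' {C | i ∈ C.1.verts} := by
    ext T
    simp [truncated, mem_verts_trunc]
  rw [this]
  exact measurableSet_preimage_truncated _ _

theorem measurableSet_pos_eq (i : List ℕ) (x : ZdPoint d) :
    MeasurableSet {T : EmbTree d | T.pos i = x} := by
  have : {T : EmbTree d | T.pos i = x} =
      truncated i.length ⁻¹' {C | C.1.pos i = x} := by
    ext T
    simp [truncated, pos_trunc_of_le]
  rw [this]
  exact measurableSet_preimage_truncated _ _

end EmbTree

/-! ### Cylinder events in terms of family sizes and displacements -/

section Marks

open EmbTree

variable {d : ℕ}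

theorem cons_mem_verts_embTreeOf {η : List ℕ → ℕ × ZdPoint d} {w : List ℕ} {j : ℕ} :
    j :: w ∈ (embTreeOf η).verts ↔ w ∈ (embTreeOf η).verts ∧ j < (η w).1 := Iff.rfl

theorem numChildren_embTreeOf {η : List ℕ → ℕ × ZdPoint d} {w : List ℕ}
    (hw : w ∈ (embTreeOf η).verts) : (embTreeOf η).numChildren w = (η w).1 := by
  refine le_antisymm (le_of_forall_lt fun j hj => ?_) (le_of_forall_lt fun j hj => ?_)
  · exact (cons_mem_verts_embTreeOf.1 (cons_mem_verts_iff.2 hj)).2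
  · exact cons_mem_verts_iff.1 (cons_mem_verts_embTreeOf.2 ⟨hw, hj⟩)

theorem pos_embTreeOf {η : List ℕ → ℕ × ZdPoint d} {w : List ℕ}
    (hw : w ∈ (embTreeOf η).verts) : (embTreeOf η).pos w = place (fun v => (η v).2) w :=
  if_pos hw

/-- The family sizes that are allowed at `v` if the first `m` generations are those of `C`. -/
def EmbTree.sizesAt (m : ℕ) (C : EmbTree d) (v : List ℕ) : Set ℕ :=
  {c | v.length < m → c = C.numChildren v}

/-- The displacements that are allowed at `v` if the first `m` generations are those of `C`;
the displacement at the root plays no role. -/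
def EmbTree.stepsAt (C : EmbTree d) (v : List ℕ) : Set (ZdPoint d) :=
  {x | v ≠ [] → x = C.pos v - C.pos v.tail}

/-- The cylinder event of `C` constrains the marks at each vertex of `C` separately. -/
theorem embTreeOf_mem_cylinder_iff {m : ℕ} {C : EmbTree d} (hC : C.trunc m = C)
    {η : List ℕ → ℕ × ZdPoint d} :
    embTreeOf η ∈ cylinder m C ↔
      ∀ v ∈ C.verts, (η v).1 ∈ C.sizesAt m v ∧ (η v).2 ∈ C.stepsAt v := by
  rw [EmbTree.mem_cylinder]
  constructor
  · intro h v hv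
    have hpos : ∀ w ∈ C.verts, C.pos w = place (fun v => (η v).2) w := by
      intro w hw
      have hl := length_le_of_mem hC hw
      rw [← h] at hw
      rw [← h, pos_trunc_of_le hl, pos_embTreeOf hw.1]
    refine ⟨fun hl => ?_, fun hne => ?_⟩
    · have hv' : v ∈ (embTreeOf η).verts := by
        rw [← h] at hv
        exact hv.1
      rw [← numChildren_embTreeOf hv', ← h]
      refine eq_of_forall_lt_iff fun j => ?_
      rw [← cons_mem_verts_iff, ← cons_mem_verts_iff, mem_verts_trunc]
      exact (and_iff_left hl).symm
    · obtain _ | ⟨j, w⟩ := v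
      · exact absurd rfl hne
      · rw [hpos _ hv, List.tail_cons, hpos _ (C.parent_mem _ _ hv)]
        exact (add_sub_cancel_left _ _).symm
  · intro h
    have hverts : ∀ w, w ∈ ((embTreeOf η).trunc m).verts ↔ w ∈ C.verts := by
      intro w
      induction w with
      | nil => exact iff_of_true (EmbTree.root_mem _) C.root_mem
      | cons j w ih =>
        rw [mem_verts_trunc, cons_mem_verts_embTreeOf]
        constructor
        · rintro ⟨⟨hw, hj⟩, hl⟩
          have hl' : w.length < m := hl
          have hwC : w ∈ C.verts := ih.1 ⟨hw, hl'.le⟩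
          rw [cons_mem_verts_iff, ← (h w hwC).1 hl']
          exact hj
        · intro hw
          have hl := length_le_of_mem hC hw
          have hl' : w.length < m := hl
          have hwC : w ∈ C.verts := C.parent_mem _ _ hw
          rw [cons_mem_verts_iff, ← (h w hwC).1 hl'] at hw
          exact ⟨⟨(ih.2 hwC).1, hw⟩, hl⟩
    have hpos : ∀ w ∈ C.verts, C.pos w = place (fun v => (η v).2) w := by
      intro w
      induction w with
      | nil => exact fun _ => C.pos_root
      | cons j w ih =>
        intro hw
        have := (h _ hw).2 (by simp)
        simp only [List.tail_cons] at this
        change _ = place _ w + (η (j :: w)).2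
        rw [this, ← ih (C.parent_mem _ _ hw), add_sub_cancel]
    refine EmbTree.ext (Set.ext hverts) ?_
    funext w
    by_cases hw : w ∈ C.verts
    · have hw' := (hverts w).2 hw
      rw [pos_trunc_of_le hw'.2, pos_embTreeOf hw'.1, hpos w hw]
    · rw [C.pos_off w hw, EmbTree.pos_off _ w fun h' => hw ((hverts w).1 h')]

theorem N_succ_embTreeOf {m : ℕ} {C : EmbTree d} {η : List ℕ → ℕ × ZdPoint d}
    (h : embTreeOf η ∈ cylinder m C) :
    (embTreeOf η).N (m + 1) = ∑ v ∈ C.level m, (η v).1 := by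
  rw [EmbTree.mem_cylinder] at h
  rw [N_succ, ← h, level_trunc le_rfl]
  exact Finset.sum_congr rfl fun v hv => numChildren_embTreeOf (mem_level.1 hv).1

end Marks

/-! ### The tree with a spine -/

section Spine

open EmbTree

variable {d : ℕ}

/-- The data attached to a potential vertex: its family size and displacement, and, for use if it
lies on the spine, the numbers of left and right siblings of its child on the spine. -/
abbrev SpineMark (d : ℕ) : Type := (ℕ × ZdPoint d) × (ℕ × ℕ)

/-- The spine: an infinite line of descent, in which each vertex has a prescribed number of left
siblings. -/
def spine (ω : List ℕ → SpineMark d) : ℕ → List ℕ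
  | 0 => []
  | n + 1 => (ω (spine ω n)).2.1 :: spine ω n

/-- The family size of a vertex with mark `x`, where `b` tells whether the vertex lies on the
spine. -/
def SpineMark.size (b : Prop) [Decidable b] (x : SpineMark d) : ℕ :=
  if b then x.2.1 + x.2.2 + 1 else x.1.1

/-- The family sizes and displacements of the tree with a spine. -/
def spineMarks (ω : List ℕ → SpineMark d) (v : List ℕ) : ℕ × ZdPoint d :=
  ((ω v).size (v = spine ω v.length), (ω v).1.2)

/-- The embedded tree with a spine. -/
noncomputable def spineTree (ω : List ℕ → SpineMark d) : EmbTree d := embTreeOf (spineMarks ω)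

@[simp]
theorem length_spine (ω : List ℕ → SpineMark d) (n : ℕ) : (spine ω n).length = n := by
  induction n with
  | zero => rfl
  | succ n ih => simp [spine, ih]

theorem spine_suffix (ω : List ℕ → SpineMark d) {m n : ℕ} (h : m ≤ n) :
    spine ω m <:+ spine ω n := by
  induction n, h using Nat.le_induction with
  | base => exact List.suffix_rfl
  | succ n _ ih => exact ih.trans (List.suffix_cons _ _)

theorem spine_mem_verts (ω : List ℕ → SpineMark d) (n : ℕ) :
    spine ω n ∈ (spineTree ω).verts := by
  induction n with
  | zero => exact EmbTree.root_mem _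
  | succ n ih =>
    refine cons_mem_verts_embTreeOf.2 ⟨ih, ?_⟩
    simp only [spineMarks, SpineMark.size, length_spine, if_true]
    omega

theorem N_spineTree_pos (ω : List ℕ → SpineMark d) (n : ℕ) : 0 < (spineTree ω).N n := by
  rw [N_eq_card_level, Finset.card_pos]
  exact ⟨spine ω n, mem_level.2 ⟨spine_mem_verts ω n, length_spine ω n⟩⟩

theorem eq_spine_iff_suffix {ω : List ℕ → SpineMark d} {m : ℕ} {i v : List ℕ}
    (hi : spine ω m = i) (hv : v.length ≤ m) : v = spine ω v.length ↔ v <:+ i := by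
  subst hi
  constructor
  · intro h
    rw [h]
    exact spine_suffix ω hv
  · intro h
    exact (List.suffix_of_suffix_length_le h (spine_suffix ω hv) (by simp)).eq_of_length (by simp)

/-- The spine passes through `i` exactly if each proper ancestor of `i` chooses as its spine child
the next vertex on the line of descent of `i`. -/
theorem spine_eq_iff {ω : List ℕ → SpineMark d} {m : ℕ} {i : List ℕ} (hi : i.length = m) :
    spine ω m = i ↔ ∀ v, v <:+ i → v.length < m → (ω v).2.1 :: v <:+ i := by
  constructor
  · intro h v hv hl
    have := (eq_spine_iff_suffix h hl.le).2 hv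
    have h2 := spine_suffix ω (Nat.succ_le_of_lt hl)
    rw [h] at h2
    rw [spine, ← this] at h2
    exact h2
  · intro h
    have : ∀ n ≤ m, spine ω n <:+ i := by
      intro n
      induction n with
      | zero => exact fun _ => List.nil_suffix
      | succ n ih =>
        intro hn
        exact h _ (ih (by omega)) (by simpa using hn)
    exact (this m le_rfl).eq_of_length (by simp [hi])

/-- The marks that are allowed at `v` if the spine passes through `i`, a vertex in generation `m`
of `C`, and the first `m` generations are those of `C`. -/
def EmbTree.spineMarksAt (m : ℕ) (C : EmbTree d) (i v : List ℕ) : Set (SpineMark d) :=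
  open Classical in
  {x | x.size (v <:+ i) ∈ C.sizesAt m v ∧ x.1.2 ∈ C.stepsAt v ∧
    (v <:+ i → v.length < m → x.2.1 :: v <:+ i)}

theorem spine_eq_and_spineTree_mem_cylinder_iff {m : ℕ} {C : EmbTree d} (hC : C.trunc m = C)
    {i : List ℕ} (hi : i ∈ C.level m) {ω : List ℕ → SpineMark d} :
    (spine ω m = i ∧ spineTree ω ∈ cylinder m C) ↔
      ∀ v ∈ C.verts, ω v ∈ C.spineMarksAt m i v := by
  classical
  obtain ⟨hiC, hil⟩ := mem_level.1 hi
  have hsize : spine ω m = i → ∀ v ∈ C.verts,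
      (spineMarks ω v).1 = (ω v).size (v <:+ i) := by
    intro h v hv
    simp only [spineMarks, SpineMark.size, eq_spine_iff_suffix h (length_le_of_mem hC hv)]
  rw [spineTree, embTreeOf_mem_cylinder_iff hC]
  constructor
  · rintro ⟨h1, h2⟩ v hv
    refine ⟨?_, (h2 v hv).2, (spine_eq_iff hil).1 h1 v⟩
    convert (h2 v hv).1 using 1
    rw [hsize h1 v hv]
  · intro h
    have h1 : spine ω m = i := (spine_eq_iff hil).2 fun v hv hl =>
      (h v (mem_verts_of_suffix hv hiC)).2.2 hv hl
    refine ⟨h1, fun v hv => ⟨?_, (h v hv).2.1⟩⟩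
    rw [hsize h1 v hv]
    convert (h v hv).1 using 1

/-- On a spine cylinder, generation `m + 1` without its spine vertex consists of the siblings of the
latter and of the children of the other vertices in generation `m`. -/
theorem N_succ_spineTree {m : ℕ} {C : EmbTree d} {i : List ℕ} (hi : i ∈ C.level m)
    {ω : List ℕ → SpineMark d} (h1 : spine ω m = i) (h2 : spineTree ω ∈ cylinder m C) :
    (spineTree ω).N (m + 1) - 1 =
      ∑ v ∈ C.level m, if v = i then (ω v).2.1 + (ω v).2.2 else (ω v).1.1 := by
  rw [spineTree, N_succ_embTreeOf h2, ← Finset.add_sum_erase _ _ hi, ← Finset.add_sum_erase _ _ hi]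
  obtain ⟨hiC, hil⟩ := mem_level.1 hi
  have hi' : (spineMarks ω i).1 = (ω i).2.1 + (ω i).2.2 + 1 := by
    simp [spineMarks, SpineMark.size, hil, h1]
  have hv : ∀ v ∈ (C.level m).erase i, (spineMarks ω v).1 =
      if v = i then (ω v).2.1 + (ω v).2.2 else (ω v).1.1 := by
    intro v hv
    obtain ⟨hne, hv⟩ := Finset.mem_erase.1 hv
    simp [spineMarks, SpineMark.size, (mem_level.1 hv).2, h1, hne]
  rw [hi', if_pos rfl, Finset.sum_congr rfl hv]
  omega

end Spine

/-! ### Integrals of products of coordinate functions -/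

section Product

theorem integral_prod_infinitePi {ι 𝕜 : Type*} [RCLike 𝕜] {X : ι → Type*}
    [∀ i, MeasurableSpace (X i)] (μ : ∀ i, Measure (X i)) [∀ i, IsProbabilityMeasure (μ i)]
    (S : Finset ι) (h : ∀ i, X i → 𝕜) (hm : ∀ i, Measurable (h i)) :
    ∫ ω, ∏ i ∈ S, h i (ω i) ∂(Measure.infinitePi μ) = ∏ i ∈ S, ∫ x, h i x ∂(μ i) := by
  have h1 := integral_restrict_infinitePi μ (s := S) (f := fun y => ∏ i : S, h i.1 (y i))
    (Measurable.aestronglyMeasurable <|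
      Finset.measurable_fun_prod _ fun i _ => (hm i.1).comp (measurable_pi_apply i))
  rw [integral_fintype_prod_eq_prod (𝕜 := 𝕜) (fun i : S => h i.1)] at h1
  rw [← Finset.prod_coe_sort S fun i => ∫ x, h i x ∂(μ i), ← h1]
  refine integral_congr_ae (ae_of_all _ fun ω => ?_)
  exact (Finset.prod_coe_sort S fun i => h i (ω i)).symm

theorem setIntegral_prod_infinitePi {ι 𝕜 : Type*} [RCLike 𝕜] {X : ι → Type*}
    [∀ i, MeasurableSpace (X i)] (μ : ∀ i, Measure (X i)) [∀ i, IsProbabilityMeasure (μ i)]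
    (S : Finset ι) (h : ∀ i, X i → 𝕜) (hm : ∀ i, Measurable (h i)) (E : ∀ i, Set (X i))
    (hE : ∀ i, MeasurableSet (E i)) :
    ∫ ω in Set.pi S E, ∏ i ∈ S, h i (ω i) ∂(Measure.infinitePi μ) =
      ∏ i ∈ S, ∫ x in E i, h i x ∂(μ i) := by
  classical
  have hpi : MeasurableSet (Set.pi (S : Set ι) E) :=
    MeasurableSet.pi S.countable_toSet fun i _ => hE i
  rw [← integral_indicator hpi]
  simp_rw [← integral_indicator (hE _)]
  rw [← integral_prod_infinitePi μ S _ fun i => (hm i).indicator (hE i)]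
  refine integral_congr_ae (ae_of_all _ fun ω => ?_)
  by_cases hω : ω ∈ Set.pi (S : Set ι) E
  · rw [Set.indicator_of_mem hω]
    exact Finset.prod_congr rfl fun i hi => (Set.indicator_of_mem (hω i hi) _).symm
  · rw [Set.indicator_of_notMem hω]
    have : ∃ i ∈ S, ω i ∉ E i := by simpa [Set.mem_pi] using hω
    obtain ⟨i, hi, hiE⟩ := this
    exact (Finset.prod_eq_zero hi (Set.indicator_of_notMem hiE _)).symm

theorem setIntegral_prod_prod {α β γ 𝕜 : Type*} [RCLike 𝕜] [MeasurableSpace α]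
    [MeasurableSpace β] [MeasurableSpace γ] (μ : Measure α) (ν : Measure β) (ρ : Measure γ)
    [IsProbabilityMeasure μ] [IsProbabilityMeasure ν] [IsProbabilityMeasure ρ]
    (f : α → 𝕜) (g : γ → 𝕜) (A : Set α) (B : Set β) (C : Set γ) :
    ∫ x in (A ×ˢ B) ×ˢ C, f x.1.1 * g x.2 ∂((μ.prod ν).prod ρ) =
      (∫ x in A, f x ∂μ) * (ν.real B : 𝕜) * ∫ x in C, g x ∂ρ := by
  rw [setIntegral_prod_mul (fun x : α × β => f x.1) g]
  congr 1
  have := setIntegral_prod_mul (μ := μ) (ν := ν) f (fun _ => (1 : 𝕜)) A B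
  simpa [mul_one, setIntegral_const, RCLike.real_smul_eq_coe_mul] using this

end Product

/-! ### The law of the tree with a spine -/

section SpineLaw

variable {d : ℕ}

/-- The law of the numbers of left and right siblings of a child on the spine. The number of
children has the size-biased offspring law, and the rank of the spine child is uniform. -/
noncomputable def siblingPMF (p : PMF ℕ) (hcrit : ∑' m : ℕ, (m : ℝ≥0∞) * p m = 1) :
    PMF (ℕ × ℕ) :=
  ⟨fun x => p (x.1 + x.2 + 1), by
    have h0 := tsum_eq_zero_add' (f := fun m : ℕ => (m : ℝ≥0∞) * p m) ENNReal.summable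
    rw [hcrit, Nat.cast_zero, zero_mul, zero_add] at h0
    rw [ENNReal.summable.hasSum_iff,
      ← Finset.HasAntidiagonal.sigmaAntidiagonalEquivProd.tsum_eq, ENNReal.tsum_sigma', h0]
    refine tsum_congr fun n => ?_
    rw [tsum_fintype, Finset.sum_congr rfl (g := fun _ => p (n + 1)) fun x _ => ?_]
    · simp
    · have := Finset.HasAntidiagonal.mem_antidiagonal.1 x.2
      simp only [Finset.HasAntidiagonal.sigmaAntidiagonalEquivProd_apply]
      rw [this]⟩

theorem siblingPMF_apply (p : PMF ℕ) (hcrit : ∑' m : ℕ, (m : ℝ≥0∞) * p m = 1) (x : ℕ × ℕ) :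
    siblingPMF p hcrit x = p (x.1 + x.2 + 1) := rfl

/-- The generating function `∑ p_k s^k`. -/
noncomputable def pgf (p : PMF ℕ) (s : ℂ) : ℂ := ∫ k, s ^ k ∂p.toMeasure

/-- The generating function of the number of siblings of a spine vertex. -/
noncomputable def siblingPgf (p : PMF ℕ) (hcrit : ∑' m : ℕ, (m : ℝ≥0∞) * p m = 1) (s : ℂ) : ℂ :=
  ∫ x, s ^ (x.1 + x.2) ∂(siblingPMF p hcrit).toMeasure

/-- The law of the mark of a potential vertex. -/
noncomputable def spineMarkLaw (p : PMF ℕ) (hcrit : ∑' m : ℕ, (m : ℝ≥0∞) * p m = 1)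
    (D : PMF (ZdPoint d)) : Measure (SpineMark d) :=
  (p.toMeasure.prod D.toMeasure).prod (siblingPMF p hcrit).toMeasure

instance (p : PMF ℕ) (hcrit : ∑' m : ℕ, (m : ℝ≥0∞) * p m = 1) (D : PMF (ZdPoint d)) :
    IsProbabilityMeasure (spineMarkLaw p hcrit D) := by
  unfold spineMarkLaw
  infer_instance

/-- The joint law of the marks of all potential vertices. -/
noncomputable def spineLaw (p : PMF ℕ) (hcrit : ∑' m : ℕ, (m : ℝ≥0∞) * p m = 1)
    (D : PMF (ZdPoint d)) : Measure (List ℕ → SpineMark d) :=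
  Measure.infinitePi fun _ : List ℕ => spineMarkLaw p hcrit D

instance (p : PMF ℕ) (hcrit : ∑' m : ℕ, (m : ℝ≥0∞) * p m = 1) (D : PMF (ZdPoint d)) :
    IsProbabilityMeasure (spineLaw p hcrit D) := by
  unfold spineLaw
  infer_instance

theorem measurableSet_spine_eq (m : ℕ) (i : List ℕ) :
    MeasurableSet {ω : List ℕ → SpineMark d | spine ω m = i} := by
  induction m generalizing i with
  | zero => exact MeasurableSet.const ([] = i)
  | succ m ih =>
    obtain _ | ⟨j, w⟩ := i
    · convert MeasurableSet.empty (α := List ℕ → SpineMark d) using 1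
      ext ω
      simp [spine]
    · have : {ω : List ℕ → SpineMark d | spine ω (m + 1) = j :: w} =
          {ω | spine ω m = w} ∩ (fun ω => (ω w).2.1) ⁻¹' {j} := by
        ext ω
        simp only [spine, List.cons.injEq, Set.mem_inter_iff, Set.mem_preimage,
          Set.mem_singleton_iff, Set.mem_ofPred_eq]
        constructor
        · rintro ⟨h1, rfl⟩
          exact ⟨rfl, h1⟩
        · rintro ⟨rfl, h1⟩
          exact ⟨h1, rfl⟩
      rw [this]
      refine (ih w).inter ?_
      have h : Measurable fun ω : List ℕ → SpineMark d => (ω w).2.1 :=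
        (measurable_fst.comp measurable_snd).comp (measurable_pi_apply w)
      exact h (measurableSet_singleton j)

theorem measurable_spineTree : Measurable (spineTree : (List ℕ → SpineMark d) → EmbTree d) := by
  refine measurable_embTreeOf.comp (measurable_pi_lambda _ fun v => ?_)
  have hv : Measurable fun ω : List ℕ → SpineMark d => ω v := measurable_pi_apply v
  refine Measurable.prodMk ?_ ((Measurable.of_discrete (f := fun x : SpineMark d => x.1.2)).comp hv)
  have hs : MeasurableSet {ω : List ℕ → SpineMark d | v = spine ω v.length} := by
    convert measurableSet_spine_eq (d := d) v.length v using 1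
    ext ω
    exact eq_comm
  exact Measurable.ite hs
    ((Measurable.of_discrete (f := fun x : SpineMark d => x.2.1 + x.2.2 + 1)).comp hv)
    ((Measurable.of_discrete (f := fun x : SpineMark d => x.1.1)).comp hv)

instance (p : PMF ℕ) (D : PMF (ZdPoint d)) : IsProbabilityMeasure (brw p D) :=
  Measure.isProbabilityMeasure_map measurable_embTreeOf.aemeasurable

theorem brw_cylinder (p : PMF ℕ) (D : PMF (ZdPoint d)) {m : ℕ} {C : EmbTree d}
    (hC : C.trunc m = C) :
    brw p D (EmbTree.cylinder m C) =
      ∏ v ∈ (EmbTree.finite_verts hC).toFinset,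
        p.toMeasure (C.sizesAt m v) * D.toMeasure (C.stepsAt v) := by
  rw [brw, Measure.map_apply measurable_embTreeOf (EmbTree.measurableSet_cylinder m C)]
  have : embTreeOf ⁻¹' EmbTree.cylinder m C =
      Set.pi (EmbTree.finite_verts hC).toFinset fun v => C.sizesAt m v ×ˢ C.stepsAt v := by
    ext η
    rw [Set.mem_preimage, embTreeOf_mem_cylinder_iff hC, Set.mem_pi]
    simp only [Set.mem_prod, Set.Finite.coe_toFinset]
  rw [this, Measure.infinitePi_pi _ fun _ _ => MeasurableSet.of_discrete]
  simp only [Measure.prod_prod]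

/-- The number of children off the spine of a vertex `v` with mark `x`, in the generation of the
spine vertex `i`. -/
def SpineMark.offspring (i v : List ℕ) (x : SpineMark d) : ℕ :=
  if v = i then x.2.1 + x.2.2 else x.1.1

variable (p : PMF ℕ) (hcrit : ∑' m : ℕ, (m : ℝ≥0∞) * p m = 1) (D : PMF (ZdPoint d))

/-- At a proper ancestor `v` of `i` on the spine, the family size and the rank of the spine child
are both prescribed, which leaves one value of the pair of sibling numbers. -/
theorem siblingPMF_fiber {m : ℕ} {C : EmbTree d} {i v : List ℕ} (hi : i ∈ C.level m)
    (hv : v <:+ i) (hl : v.length < m) :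
    (siblingPMF p hcrit).toMeasure {x | x.1 + x.2 + 1 = C.numChildren v ∧ x.1 :: v <:+ i} =
      p (C.numChildren v) := by
  obtain ⟨hiC, hil⟩ := EmbTree.mem_level.1 hi
  obtain ⟨u, rfl⟩ := hv
  obtain rfl | ⟨u, r, rfl⟩ := u.eq_nil_or_concat'
  · simp at hil
    omega
  have hr : r < C.numChildren v := by
    rw [← EmbTree.cons_mem_verts_iff]
    exact EmbTree.mem_verts_of_suffix ⟨u, by simp⟩ hiC
  have : {x : ℕ × ℕ | x.1 + x.2 + 1 = C.numChildren v ∧ x.1 :: v <:+ u ++ [r] ++ v} =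
      {(r, C.numChildren v - 1 - r)} := by
    ext ⟨a, b⟩
    have hs : a :: v <:+ u ++ [r] ++ v ↔ a = r := by
      constructor
      · intro h
        have h2 : r :: v <:+ u ++ [r] ++ v := ⟨u, by simp⟩
        have := (List.suffix_of_suffix_length_le h h2 (by simp)).eq_of_length (by simp)
        simpa using this
      · rintro rfl
        exact ⟨u, by simp⟩
    simp only [Set.mem_ofPred_eq, hs, Set.mem_singleton_iff, Prod.mk.injEq]
    omega
  rw [this, PMF.toMeasure_apply_singleton _ _ (measurableSet_singleton _), siblingPMF_apply]
  congr 1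
  simp only
  omega

/-- The one-vertex factor: along the spine, size-biasing the family and choosing the spine child
uniformly in it reproduces the weight which the vertex has in the original branching random walk. -/
theorem setIntegral_spineMarksAt {m : ℕ} {C : EmbTree d} (hC : C.trunc m = C) {i v : List ℕ}
    (hi : i ∈ C.level m) (hvC : v ∈ C.verts) (s : ℂ) :
    ∫ x in C.spineMarksAt m i v, (if v.length = m then s ^ x.offspring i v else 1)
        ∂(spineMarkLaw p hcrit D) =
      ((p.toMeasure (C.sizesAt m v) * D.toMeasure (C.stepsAt v)).toReal : ℂ) *
        if v.length = m then (if v = i then siblingPgf p hcrit s else pgf p s) else 1 := by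
  classical
  obtain ⟨hiC, hil⟩ := EmbTree.mem_level.1 hi
  rw [ENNReal.toReal_mul, Complex.ofReal_mul]
  rcases (EmbTree.length_le_of_mem hC hvC).eq_or_lt with hl | hl
  · have hsz : C.sizesAt m v = Set.univ := by
      ext c
      simp [EmbTree.sizesAt, hl]
    have hset : C.spineMarksAt m i v = (Set.univ ×ˢ C.stepsAt v) ×ˢ Set.univ := by
      ext x
      simp [EmbTree.spineMarksAt, hsz, hl]
    rw [hset, hsz]
    simp only [hl, if_true, measure_univ, ENNReal.toReal_one, Complex.ofReal_one, one_mul]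
    -- in generation `m` only the displacement is constrained, and it is independent of the family
    by_cases hvi : v = i
    · have := setIntegral_prod_prod p.toMeasure D.toMeasure (siblingPMF p hcrit).toMeasure
        (fun _ => (1 : ℂ)) (fun x => s ^ (x.1 + x.2)) Set.univ (C.stepsAt v) Set.univ
      simpa [SpineMark.offspring, hvi, spineMarkLaw, siblingPgf, Measure.real] using this
    · have := setIntegral_prod_prod p.toMeasure D.toMeasure (siblingPMF p hcrit).toMeasure
        (fun k => s ^ k) (fun _ => (1 : ℂ)) Set.univ (C.stepsAt v) Set.univ
      simp only [SpineMark.offspring, hvi, if_false, spineMarkLaw]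
      simp only [mul_one, Measure.restrict_univ, integral_const, probReal_univ, one_smul] at this
      rw [this, mul_comm]
      rfl
  · simp only [hl.ne, if_false, mul_one]
    have hsz : C.sizesAt m v = {C.numChildren v} := by
      ext c
      simp [EmbTree.sizesAt, hl]
    by_cases hvi : v <:+ i
    · have hset : C.spineMarksAt m i v = (Set.univ ×ˢ C.stepsAt v) ×ˢ
          {x | x.1 + x.2 + 1 = C.numChildren v ∧ x.1 :: v <:+ i} := by
        ext x
        simp only [EmbTree.spineMarksAt, hsz, SpineMark.size, hvi, hl, if_true, Set.mem_ofPred_eq,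
          Set.mem_singleton_iff, Set.mem_prod, Set.mem_univ, true_and, forall_true_left]
        tauto
      rw [hset, spineMarkLaw, hsz, PMF.toMeasure_apply_singleton _ _ (measurableSet_singleton _),
        ← siblingPMF_fiber p hcrit hi hvi hl, mul_comm (Complex.ofReal _)]
      simp [Measure.real]
    · have hset : C.spineMarksAt m i v = (C.sizesAt m v ×ˢ C.stepsAt v) ×ˢ Set.univ := by
        ext x
        simp [EmbTree.spineMarksAt, SpineMark.size, hvi]
      rw [hset, spineMarkLaw]
      simp [Measure.real]

/-- The event that the spine passes through `i` and that the first `m` generations are those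
of `C`. -/
def spineCylinder (m : ℕ) (C : EmbTree d) (i : List ℕ) : Set (List ℕ → SpineMark d) :=
  {ω | spine ω m = i ∧ spineTree ω ∈ EmbTree.cylinder m C}

theorem measurableSet_spineCylinder (m : ℕ) (C : EmbTree d) (i : List ℕ) :
    MeasurableSet (spineCylinder m C i) :=
  (measurableSet_spine_eq m i).inter
    (measurable_spineTree (EmbTree.measurableSet_cylinder m C))

/-- Given the first `m` generations and the spine up to generation `m`, the families of the
vertices in generation `m` are independent, size-biased for the vertex on the spine. -/
theorem setIntegral_spineCylinder {m : ℕ} {C : EmbTree d} (hC : C.trunc m = C) {i : List ℕ}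
    (hi : i ∈ C.level m) (s : ℂ) :
    ∫ ω in spineCylinder m C i, s ^ ((spineTree ω).N (m + 1) - 1) ∂(spineLaw p hcrit D) =
      ((brw p D).real (EmbTree.cylinder m C) : ℂ) *
        (siblingPgf p hcrit s * pgf p s ^ (C.N m - 1)) := by
  classical
  set V := (EmbTree.finite_verts hC).toFinset with hV
  have hsub : C.level m ⊆ V := fun v hv => by simpa [hV] using (EmbTree.mem_level.1 hv).1
  have hout : ∀ v ∈ V, v ∉ C.level m → v.length ≠ m := fun v hv hv' hl =>
    hv' (EmbTree.mem_level.2 ⟨by simpa [hV] using hv, hl⟩)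
  have hpi : spineCylinder m C i = Set.pi V fun v => C.spineMarksAt m i v := by
    ext ω
    rw [spineCylinder, Set.mem_ofPred_eq, spine_eq_and_spineTree_mem_cylinder_iff hC hi,
      Set.mem_pi]
    simp [hV]
  have h1 : ∫ ω in spineCylinder m C i, s ^ ((spineTree ω).N (m + 1) - 1) ∂(spineLaw p hcrit D) =
      ∫ ω in spineCylinder m C i,
        ∏ v ∈ V, (if v.length = m then s ^ (ω v).offspring i v else 1) ∂(spineLaw p hcrit D) := by
    refine setIntegral_congr_fun (measurableSet_spineCylinder m C i) fun ω hω => ?_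
    rw [N_succ_spineTree hi hω.1 hω.2, ← Finset.prod_pow_eq_pow_sum,
      ← Finset.prod_subset hsub fun v hv hv' => if_neg (hout v hv hv')]
    refine Finset.prod_congr rfl fun v hv => ?_
    rw [if_pos (EmbTree.mem_level.1 hv).2]
    rfl
  rw [h1, hpi, spineLaw, setIntegral_prod_infinitePi (fun _ => spineMarkLaw p hcrit D) V
    (fun v x => if v.length = m then s ^ x.offspring i v else 1)
    (fun _ => Measurable.of_discrete) _ (fun _ => MeasurableSet.of_discrete),
    Finset.prod_congr rfl fun v hv =>
      setIntegral_spineMarksAt p hcrit D hC hi (by simpa [hV] using hv) s,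
    Finset.prod_mul_distrib]
  congr 1
  · rw [Measure.real, brw_cylinder p D hC, ENNReal.toReal_prod, Complex.ofReal_prod]
  · rw [← Finset.prod_subset hsub fun v hv hv' => if_neg (hout v hv hv'),
      ← Finset.mul_prod_erase _ _ hi, if_pos (EmbTree.mem_level.1 hi).2, if_pos rfl,
      Finset.prod_congr rfl (g := fun _ => pgf p s), Finset.prod_const,
      Finset.card_erase_of_mem hi, EmbTree.N_eq_card_level]
    intro v hv
    obtain ⟨hne, hv⟩ := Finset.mem_erase.1 hv
    rw [if_pos (EmbTree.mem_level.1 hv).2, if_neg hne]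

/-- The case `s = 1` of `setIntegral_spineCylinder`. -/
theorem spineLaw_spineCylinder {m : ℕ} {C : EmbTree d} (hC : C.trunc m = C) {i : List ℕ}
    (hi : i ∈ C.level m) :
    spineLaw p hcrit D (spineCylinder m C i) = brw p D (EmbTree.cylinder m C) := by
  have h := setIntegral_spineCylinder p hcrit D hC hi 1
  simp only [one_pow, siblingPgf, pgf, integral_const, probReal_univ, one_smul, mul_one,
    measureReal_restrict_apply_univ, Complex.real_smul, Complex.ofReal_inj] at h
  exact (ENNReal.toReal_eq_toReal_iff' (measure_ne_top _ _) (measure_ne_top _ _)).1 h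

end SpineLaw

/-! ### Existence and uniqueness of the incipient infinite branching random walk -/

section Existence

variable {d : ℕ} (p : PMF ℕ) (hcrit : ∑' m : ℕ, (m : ℝ≥0∞) * p m = 1) (D : PMF (ZdPoint d))

/-- The law of the tree with a spine, which is the incipient infinite branching random walk. -/
noncomputable def iibrw : ProbabilityMeasure (EmbTree d) :=
  ⟨(spineLaw p hcrit D).map spineTree,
    Measure.isProbabilityMeasure_map measurable_spineTree.aemeasurable⟩

theorem iibrw_apply {A : Set (EmbTree d)} (hA : MeasurableSet A) :
    (iibrw p hcrit D : Measure (EmbTree d)) A = spineLaw p hcrit D (spineTree ⁻¹' A) :=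
  Measure.map_apply measurable_spineTree hA

/-- The law of the first `m` generations is that of the branching random walk, biased by the size
of generation `m`. -/
theorem iibrw_cylinder {m : ℕ} {C : EmbTree d} (hC : C.trunc m = C) :
    (iibrw p hcrit D : Measure (EmbTree d)) (EmbTree.cylinder m C) =
      C.N m * brw p D (EmbTree.cylinder m C) := by
  rw [iibrw_apply p hcrit D (EmbTree.measurableSet_cylinder m C)]
  have : spineTree ⁻¹' EmbTree.cylinder m C = ⋃ i ∈ C.level m, spineCylinder m C i := by
    ext ω
    simp only [Set.mem_preimage, Set.mem_iUnion, exists_prop, spineCylinder, Set.mem_ofPred_eq]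
    constructor
    · intro h
      refine ⟨spine ω m, ?_, rfl, h⟩
      rw [← EmbTree.mem_cylinder.1 h, EmbTree.level_trunc le_rfl]
      exact EmbTree.mem_level.2 ⟨spine_mem_verts ω m, length_spine ω m⟩
    · rintro ⟨i, -, -, h⟩
      exact h
  rw [this, measure_biUnion_finset ?_ fun i _ => measurableSet_spineCylinder m C i,
    Finset.sum_congr rfl fun i hi => spineLaw_spineCylinder p hcrit D hC hi, Finset.sum_const,
    EmbTree.N_eq_card_level, nsmul_eq_mul]
  intro i _ j _ hij
  rw [Function.onFun, Set.disjoint_left]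
  rintro ω ⟨h1, -⟩ ⟨h2, -⟩
  exact hij (h1.symm.trans h2)

theorem measure_eq_tsum_inter_cylinder (P : Measure (EmbTree d)) (n : ℕ) {A : Set (EmbTree d)}
    (hA : MeasurableSet A) :
    P A = ∑' C : {C : EmbTree d // C.trunc n = C}, P (A ∩ EmbTree.cylinder n C.1) := by
  rw [← measure_iUnion]
  · congr 1
    ext T
    simp only [Set.mem_iUnion, Set.mem_inter_iff]
    constructor
    · exact fun h => ⟨T.truncated n, h, rfl⟩
    · rintro ⟨_, h, _⟩
      exact h
  · intro C C' hCC'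
    rw [Function.onFun, Set.disjoint_left]
    rintro T ⟨-, h1⟩ ⟨-, h2⟩
    exact hCC' ((EmbTree.truncated_eq_iff.2 h1).symm.trans (EmbTree.truncated_eq_iff.2 h2))
  · exact fun C => hA.inter (EmbTree.measurableSet_cylinder n C.1)

theorem tsum_length_mem_verts (C : EmbTree d) (n : ℕ) (c : ℝ≥0∞) :
    ∑' i : {i : List ℕ // i.length = n}, {i | i ∈ C.verts}.indicator (fun _ => c) i.1 =
      C.N n * c := by
  refine (tsum_subtype {i : List ℕ | i.length = n} ({i | i ∈ C.verts}.indicator fun _ => c)).trans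
    ?_
  rw [tsum_eq_sum (s := C.level n), EmbTree.N_eq_card_level, ← nsmul_eq_mul, ← Finset.sum_const]
  · refine Finset.sum_congr rfl fun i hi => ?_
    obtain ⟨h1, h2⟩ := EmbTree.mem_level.1 hi
    rw [Set.indicator_of_mem (by exact h2), Set.indicator_of_mem (by exact h1)]
  · intro i hi
    by_cases h2 : i.length = n
    · rw [Set.indicator_of_mem (by exact h2), Set.indicator_of_notMem]
      exact fun h1 => hi (EmbTree.mem_level.2 ⟨h1, h2⟩)
    · exact Set.indicator_of_notMem (by exact h2 : i ∉ {i : List ℕ | i.length = n}) _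

/-- The sum over the places of the vertices in generation `n` can be dropped. -/
theorem brwTilted_eq_tsum (n m : ℕ) (C : EmbTree d) :
    brwTilted p D n m C = ∑' i : {i : List ℕ // i.length = n},
      brw p D ({T | i.1 ∈ T.verts} ∩ EmbTree.cylinder m C) := by
  rw [brwTilted, ENNReal.tsum_comm]
  refine tsum_congr fun i => ?_
  rw [← measure_iUnion]
  · congr 1
    ext T
    simp
  · intro x y hxy
    rw [Function.onFun, Set.disjoint_left]
    rintro T ⟨-, -, h1⟩ ⟨-, -, h2⟩
    exact hxy (h1.symm.trans h2)
  · exact fun x => (EmbTree.measurableSet_mem_verts i.1).inter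
      ((EmbTree.measurableSet_cylinder m C).inter (EmbTree.measurableSet_pos_eq i.1 x))

/-- The limit defining the incipient infinite measure is attained as soon as `n ≥ m`. -/
theorem brwTilted_eq_iibrw {n m : ℕ} (hmn : m ≤ n) (C : EmbTree d) :
    brwTilted p D n m C = (iibrw p hcrit D : Measure (EmbTree d)) (EmbTree.cylinder m C) := by
  classical
  have hempty : ∀ C' : EmbTree d, C'.trunc m ≠ C →
      EmbTree.cylinder m C ∩ EmbTree.cylinder n C' = ∅ := by
    intro C' h
    refine Set.eq_empty_of_forall_notMem ?_
    rintro T ⟨h1, h2⟩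
    rw [EmbTree.mem_cylinder] at h1 h2
    exact h (by rw [← h2, EmbTree.trunc_trunc hmn, h1])
  have hsub : ∀ C' : EmbTree d, C'.trunc m = C → EmbTree.cylinder n C' ⊆ EmbTree.cylinder m C := by
    intro C' h T hT
    rw [EmbTree.mem_cylinder] at hT ⊢
    rw [← EmbTree.trunc_trunc hmn, hT, h]
  rw [brwTilted_eq_tsum, measure_eq_tsum_inter_cylinder _ n (EmbTree.measurableSet_cylinder m C)]
  simp_rw [measure_eq_tsum_inter_cylinder (brw p D) n
    ((EmbTree.measurableSet_mem_verts _).inter (EmbTree.measurableSet_cylinder m C)),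
    Set.inter_assoc]
  rw [ENNReal.tsum_comm]
  refine tsum_congr fun C' => ?_
  by_cases h : C'.1.trunc m = C
  · rw [Set.inter_eq_right.2 (hsub _ h), iibrw_cylinder p hcrit D C'.2, ← tsum_length_mem_verts]
    refine tsum_congr fun i => ?_
    -- whether `i` is born is decided by the first `n` generations
    have hmem : ∀ T ∈ EmbTree.cylinder n C'.1, (i.1 ∈ T.verts ↔ i.1 ∈ C'.1.verts) := by
      intro T hT
      rw [← EmbTree.mem_cylinder.1 hT, EmbTree.mem_verts_trunc, and_iff_left i.2.le]
    by_cases hi : i.1 ∈ C'.1.verts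
    · rw [Set.indicator_of_mem (by exact hi)]
      congr 1
      exact Set.inter_eq_right.2 fun T hT => (hmem T hT).2 hi
    · rw [Set.indicator_of_notMem (by exact hi)]
      convert measure_empty (μ := brw p D)
      exact Set.eq_empty_of_forall_notMem fun T hT => hi ((hmem T hT.2).1 hT.1)
  · simp [hempty _ h]

theorem isIIBRW_iibrw : IsIIBRW p D (iibrw p hcrit D) := by
  intro m C
  refine tendsto_const_nhds.congr' ?_
  filter_upwards [eventually_ge_atTop m] with n hn
  exact (brwTilted_eq_iibrw p hcrit D hn C).symm

variable {p D} in
theorem IsIIBRW.eq_iibrw {P : ProbabilityMeasure (EmbTree d)} (hP : IsIIBRW p D P) :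
    P = iibrw p hcrit D := by
  have h : (P : Measure (EmbTree d)) = (iibrw p hcrit D : Measure (EmbTree d)) :=
    EmbTree.measure_ext_of_cylinder fun m C =>
      tendsto_nhds_unique (hP m C) (isIIBRW_iibrw p hcrit D m C)
  exact Subtype.ext h

end Existence

/-! ### The generating function of the generation sizes -/

section GeneratingFunction

variable {d : ℕ} (p : PMF ℕ) (hcrit : ∑' m : ℕ, (m : ℝ≥0∞) * p m = 1) (D : PMF (ZdPoint d))

theorem norm_pgf_le_one {s : ℂ} (hs : ‖s‖ ≤ 1) : ‖pgf p s‖ ≤ 1 := by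
  refine (norm_integral_le_of_norm_le_const (C := 1) (ae_of_all _ fun k => ?_)).trans (by simp)
  rw [norm_pow]
  exact pow_le_one₀ (norm_nonneg _) hs

/-- The generating function of the number of vertices of generation `m` off the spine. -/
noncomputable def levelPgf (m : ℕ) (s : ℂ) : ℂ :=
  ∫ ω, s ^ ((spineTree ω).N m - 1) ∂(spineLaw p hcrit D)

theorem levelPgf_zero (s : ℂ) : levelPgf p hcrit D 0 s = 1 := by
  simp [levelPgf, EmbTree.N_eq_card_level, EmbTree.level_zero]

/-- Decomposition with respect to the first `m` generations and the spine up to generation `m`. -/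
theorem hasSum_setIntegral_spineCylinder (m n : ℕ) {s : ℂ} (hs : ‖s‖ ≤ 1) :
    HasSum (fun x : (Σ C : {C : EmbTree d // C.trunc m = C}, C.1.level m) =>
      ∫ ω in spineCylinder m x.1.1 x.2.1, s ^ ((spineTree ω).N n - 1) ∂(spineLaw p hcrit D))
      (levelPgf p hcrit D n s) := by
  have hU : (⋃ x : (Σ C : {C : EmbTree d // C.trunc m = C}, C.1.level m),
      spineCylinder m x.1.1 x.2.1) = Set.univ := by
    refine Set.eq_univ_of_forall fun ω => Set.mem_iUnion.2
      ⟨⟨(spineTree ω).truncated m, spine ω m, ?_⟩, rfl, rfl⟩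
    rw [EmbTree.truncated, EmbTree.level_trunc le_rfl]
    exact EmbTree.mem_level.2 ⟨spine_mem_verts ω m, length_spine ω m⟩
  have hmeas : Measurable fun ω : List ℕ → SpineMark d => s ^ ((spineTree ω).N n - 1) :=
    (Measurable.of_discrete (f := fun k : ℕ => s ^ (k - 1))).comp
      ((EmbTree.measurable_N n).comp measurable_spineTree)
  have hint : Integrable (fun ω : List ℕ → SpineMark d => s ^ ((spineTree ω).N n - 1))
      (spineLaw p hcrit D) := by
    refine Integrable.of_bound hmeas.aestronglyMeasurable 1 (ae_of_all _ fun ω => ?_)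
    rw [norm_pow]
    exact pow_le_one₀ (norm_nonneg _) hs
  have h := hasSum_integral_iUnion (μ := spineLaw p hcrit D)
    (f := fun ω => s ^ ((spineTree ω).N n - 1))
    (s := fun x : (Σ C : {C : EmbTree d // C.trunc m = C}, C.1.level m) =>
      spineCylinder m x.1.1 x.2.1) (fun x => measurableSet_spineCylinder _ _ _) ?_
      hint.integrableOn
  · rwa [hU, setIntegral_univ] at h
  · rintro ⟨C, i⟩ ⟨C', i'⟩ hne
    rw [Function.onFun, Set.disjoint_left]
    rintro ω ⟨h1, h2⟩ ⟨h3, h4⟩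
    obtain rfl := (EmbTree.truncated_eq_iff.2 h2).symm.trans (EmbTree.truncated_eq_iff.2 h4)
    obtain rfl := Subtype.ext (h1.symm.trans h3)
    exact hne rfl

/-- The recursion `E∞[s^(N_{m+1} - 1)] = f'(s) E∞[f(s)^(N_m - 1)]`. -/
theorem levelPgf_succ (m : ℕ) {s : ℂ} (hs : ‖s‖ ≤ 1) :
    levelPgf p hcrit D (m + 1) s = siblingPgf p hcrit s * levelPgf p hcrit D m (pgf p s) := by
  have h1 := hasSum_setIntegral_spineCylinder p hcrit D m (m + 1) hs
  have h2 := (hasSum_setIntegral_spineCylinder p hcrit D m m (norm_pgf_le_one p hs)).mul_left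
    (siblingPgf p hcrit s)
  refine h1.unique (h2.congr_fun ?_)
  rintro ⟨⟨C, hC⟩, i, hi⟩
  dsimp only
  have hconst : ∀ ω ∈ spineCylinder m C i,
      pgf p s ^ ((spineTree ω).N m - 1) = pgf p s ^ (C.N m - 1) := by
    intro ω hω
    rw [← EmbTree.mem_cylinder.1 hω.2, EmbTree.N_trunc le_rfl]
  rw [setIntegral_spineCylinder p hcrit D hC hi,
    setIntegral_congr_fun (measurableSet_spineCylinder m C i) hconst, setIntegral_const,
    measureReal_def, measureReal_def, spineLaw_spineCylinder p hcrit D hC hi, Complex.real_smul]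
  ring

theorem levelPgf_eq_prod (m : ℕ) {s : ℂ} (hs : ‖s‖ ≤ 1) :
    levelPgf p hcrit D m s = ∏ k ∈ Finset.range m, siblingPgf p hcrit ((pgf p)^[k] s) := by
  induction m generalizing s with
  | zero => simp [levelPgf_zero]
  | succ m ih =>
    rw [levelPgf_succ p hcrit D m hs, ih (norm_pgf_le_one p hs), Finset.prod_range_succ']
    simp only [Function.iterate_succ_apply, Function.iterate_zero_apply]
    exact mul_comm _ _

end GeneratingFunction

/-! ### Iteration near a parabolic fixed point -/

section Iteration

/-- One step of the iteration `u ↦ u'`, in the coordinate `u = s - 1` centred at the parabolic fixed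
point: in the coordinate `1 / u` it is nearly the translation by `-b`, and the multiplier `g` is
nearly the square of the ratio `u' / u`. -/
theorem parabolic_step {b M ε : ℝ} (hb : 0 ≤ b) (hM : 0 ≤ M) (hε : 0 ≤ ε)
    (hsmall : (b + M) * ε ≤ 1 / 2) (hε1 : ε ≤ 1) {u u' g : ℂ} (hu0 : u ≠ 0) (hu : ‖u‖ ≤ ε)
    (hu' : ‖u' - u - b * u ^ 2‖ ≤ M * ‖u‖ ^ 3) (hg : ‖g - 1 - 2 * b * u‖ ≤ M * ‖u‖ ^ 2) :
    u' ≠ 0 ∧ ‖1 / u' - 1 / u + b‖ ≤ 2 * (b * (b + M) + M) * ε ∧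
      ‖g / (u' / u) ^ 2 - 1‖ ≤ 4 * (3 * M + (b + M) ^ 2) * ε ^ 2 := by
  obtain ⟨δ, hδ⟩ : ∃ δ : ℂ, u' = u * (1 + u * (b + δ)) := by
    refine ⟨(u' - u - b * u ^ 2) / u ^ 2, ?_⟩
    field_simp
    ring
  have hun : 0 < ‖u‖ := norm_pos_iff.2 hu0
  have hδn : ‖δ‖ ≤ M * ε := by
    have h1 : u' - u - b * u ^ 2 = u ^ 2 * δ := by
      rw [hδ]
      ring
    rw [h1, norm_mul, norm_pow] at hu'
    have h2 : ‖u‖ ^ 2 * ‖δ‖ ≤ ‖u‖ ^ 2 * (M * ‖u‖) := by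
      refine hu'.trans (le_of_eq ?_)
      ring
    exact (le_of_mul_le_mul_left h2 (by positivity)).trans (mul_le_mul_of_nonneg_left hu hM)
  have hbδ : ‖(b : ℂ) + δ‖ ≤ b + M := by
    refine (norm_add_le _ _).trans ?_
    rw [Complex.norm_real, Real.norm_of_nonneg hb]
    have : M * ε ≤ M * 1 := mul_le_mul_of_nonneg_left hε1 hM
    linarith
  set w : ℂ := u * (b + δ) with hw
  have hwn : ‖w‖ ≤ (b + M) * ε := by
    rw [hw, norm_mul, mul_comm (b + M)]
    exact mul_le_mul hu hbδ (norm_nonneg _) hε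
  have hr : 1 / 2 ≤ ‖1 + w‖ := by
    have := norm_sub_le (1 + w) w
    rw [add_sub_cancel_right, norm_one] at this
    linarith
  have hr0 : 1 + w ≠ 0 := norm_pos_iff.1 (by linarith)
  have hu'0 : u' ≠ 0 := by
    rw [hδ]
    exact mul_ne_zero hu0 hr0
  refine ⟨hu'0, ?_, ?_⟩
  · have h1 : 1 / u' - 1 / u + b = (b * w - δ) / (1 + w) := by
      rw [hδ]
      field_simp
      rw [hw]
      ring
    have h2 : ‖(b : ℂ) * w - δ‖ ≤ b * ((b + M) * ε) + M * ε := by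
      refine (norm_sub_le _ _).trans (add_le_add ?_ hδn)
      rw [norm_mul, Complex.norm_real, Real.norm_of_nonneg hb]
      exact mul_le_mul_of_nonneg_left hwn hb
    rw [h1, norm_div, div_le_iff₀ (by linarith)]
    have h3 : 0 ≤ (b * (b + M) + M) * ε := by positivity
    nlinarith
  · have hratio : u' / u = 1 + w := by
      rw [hδ]
      field_simp
    have h1 : g / (u' / u) ^ 2 - 1 = (g - 1 - 2 * b * u - 2 * (u * δ) - w ^ 2) / (1 + w) ^ 2 := by
      rw [hratio]
      field_simp
      rw [hw]
      ring
    have h2 : ‖g - 1 - 2 * b * u - 2 * (u * δ) - w ^ 2‖ ≤ (3 * M + (b + M) ^ 2) * ε ^ 2 := by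
      have e1 : ‖g - 1 - 2 * b * u‖ ≤ M * ε ^ 2 :=
        hg.trans (mul_le_mul_of_nonneg_left (pow_le_pow_left₀ (norm_nonneg _) hu 2) hM)
      have e2 : ‖2 * (u * δ)‖ ≤ 2 * (ε * (M * ε)) := by
        rw [norm_mul, norm_mul, Complex.norm_ofNat]
        gcongr
      have e3 : ‖w ^ 2‖ ≤ ((b + M) * ε) ^ 2 := by
        rw [norm_pow]
        gcongr
      refine (norm_sub_le _ _).trans ((add_le_add ((norm_sub_le _ _).trans
        (add_le_add e1 e2)) e3).trans (le_of_eq ?_))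
      ring
    rw [h1, norm_div, norm_pow, div_le_iff₀ (by positivity)]
    have h3 : 0 ≤ (3 * M + (b + M) ^ 2) * ε ^ 2 := by positivity
    have h4 : 1 / 4 ≤ ‖1 + w‖ ^ 2 := by nlinarith
    nlinarith

/-- Asymptotics of the orbit of `s` and of the product of the multipliers `G` along it, with errors
that are small as long as `m * ‖s - 1‖ ^ 2` is. -/
theorem parabolic_iterate {F G : ℂ → ℂ} {b M : ℝ} (hb : 0 ≤ b) (hM : 0 ≤ M)
    (hF1 : ∀ s, ‖s‖ ≤ 1 → ‖F s‖ ≤ 1) (hF2 : ∀ s, ‖s‖ ≤ 1 → ‖F s - 1‖ ≤ ‖s - 1‖)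
    (hF : ∀ s, ‖s‖ ≤ 1 → ‖(F s - 1) - (s - 1) - b * (s - 1) ^ 2‖ ≤ M * ‖s - 1‖ ^ 3)
    (hG : ∀ s, ‖s‖ ≤ 1 → ‖G s - 1 - 2 * b * (s - 1)‖ ≤ M * ‖s - 1‖ ^ 2)
    {s : ℂ} (hs : ‖s‖ ≤ 1) (hs1 : s ≠ 1) (hsmall : (b + M) * ‖s - 1‖ ≤ 1 / 2)
    (hsmall' : ‖s - 1‖ ≤ 1) (m : ℕ) :
    ‖(s - 1) / (F^[m] s - 1) - (1 - b * (m * (s - 1)))‖ ≤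
        2 * (b * (b + M) + M) * (m * ‖s - 1‖ ^ 2) ∧
      ‖(∏ k ∈ Finset.range m, G (F^[k] s)) * ((s - 1) / (F^[m] s - 1)) ^ 2 - 1‖ ≤
        Real.exp (4 * (3 * M + (b + M) ^ 2) * (m * ‖s - 1‖ ^ 2)) - 1 := by
  set u : ℕ → ℂ := fun k => F^[k] s - 1 with hu
  have hu_zero : u 0 = s - 1 := rfl
  have hnorm : ∀ k, ‖F^[k] s‖ ≤ 1 ∧ ‖u k‖ ≤ ‖s - 1‖ := by
    intro k
    induction k with
    | zero => exact ⟨hs, le_rfl⟩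
    | succ k ih =>
      simp only [hu, Function.iterate_succ_apply']
      exact ⟨hF1 _ ih.1, (hF2 _ ih.1).trans ih.2⟩
  have hstep : ∀ k, u k ≠ 0 → u (k + 1) ≠ 0 ∧
      ‖1 / u (k + 1) - 1 / u k + b‖ ≤ 2 * (b * (b + M) + M) * ‖s - 1‖ ∧
      ‖G (F^[k] s) / (u (k + 1) / u k) ^ 2 - 1‖ ≤
        4 * (3 * M + (b + M) ^ 2) * ‖s - 1‖ ^ 2 := by
    intro k hk
    refine parabolic_step hb hM (norm_nonneg _) hsmall hsmall' hk (hnorm k).2 ?_ (hG _ (hnorm k).1)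
    have := hF _ (hnorm k).1
    rwa [← Function.iterate_succ_apply' F] at this
  have hne : ∀ k, u k ≠ 0 := by
    intro k
    induction k with
    | zero => exact sub_ne_zero.2 hs1
    | succ k ih => exact (hstep k ih).1
  have hu0 := hne 0
  constructor
  · have hsum : ∀ k : ℕ, ‖1 / u k - 1 / u 0 + b * k‖ ≤ k * (2 * (b * (b + M) + M) * ‖s - 1‖) := by
      intro k
      induction k with
      | zero => simp
      | succ k ih =>
        have h1 : 1 / u (k + 1) - 1 / u 0 + b * ((k + 1 : ℕ) : ℂ) =
            (1 / u k - 1 / u 0 + b * k) + (1 / u (k + 1) - 1 / u k + b) := by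
          push_cast
          ring
        rw [h1]
        refine (norm_add_le _ _).trans ((add_le_add ih (hstep k (hne k)).2.1).trans (le_of_eq ?_))
        push_cast
        ring
    have h1 : (s - 1) / (F^[m] s - 1) - (1 - b * (m * (s - 1))) =
        (s - 1) * (1 / u m - 1 / u 0 + b * m) := by
      rw [← hu_zero]
      change u 0 / u m - _ = _
      have := hne m
      field_simp
      ring
    rw [h1, norm_mul]
    refine (mul_le_mul_of_nonneg_left (hsum m) (norm_nonneg _)).trans (le_of_eq ?_)
    ring
  · have h1 : (∏ k ∈ Finset.range m, G (F^[k] s)) * ((s - 1) / (F^[m] s - 1)) ^ 2 =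
        ∏ k ∈ Finset.range m, (1 + (G (F^[k] s) / (u (k + 1) / u k) ^ 2 - 1)) := by
      simp only [add_sub_cancel]
      -- the squares of the ratios telescope
      have htel : ∀ n : ℕ, ∏ k ∈ Finset.range n, u (k + 1) / u k = u n / u 0 := by
        intro n
        induction n with
        | zero => simp [hu0]
        | succ n ih =>
          rw [Finset.prod_range_succ, ih, div_mul_div_comm, mul_comm (u n), mul_div_mul_right _ _
            (hne n)]
      rw [Finset.prod_div_distrib, Finset.prod_pow, htel, ← hu_zero]
      change _ * (u 0 / u m) ^ 2 = _
      have := hne m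
      field_simp
    rw [h1]
    refine (Finset.norm_prod_one_add_sub_one_le _ _).trans ?_
    refine sub_le_sub_right (Real.exp_le_exp.2 ?_) 1
    refine (Finset.sum_le_sum fun k _ => (hstep k (hne k)).2.2).trans (le_of_eq ?_)
    rw [Finset.sum_const, Finset.card_range, nsmul_eq_mul]
    ring

/-- If `m (s_m - 1) → w`, the product of the first `m` multipliers along the orbit of `s_m` under
the parabolic map `F` converges to `(1 - b w)⁻²`. -/
theorem tendsto_prod_parabolic {F G : ℂ → ℂ} {b M : ℝ} (hb : 0 ≤ b) (hM : 0 ≤ M)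
    (hF1 : ∀ s, ‖s‖ ≤ 1 → ‖F s‖ ≤ 1) (hF2 : ∀ s, ‖s‖ ≤ 1 → ‖F s - 1‖ ≤ ‖s - 1‖)
    (hF : ∀ s, ‖s‖ ≤ 1 → ‖(F s - 1) - (s - 1) - b * (s - 1) ^ 2‖ ≤ M * ‖s - 1‖ ^ 3)
    (hG : ∀ s, ‖s‖ ≤ 1 → ‖G s - 1 - 2 * b * (s - 1)‖ ≤ M * ‖s - 1‖ ^ 2)
    {s : ℕ → ℂ} (hs : ∀ m, ‖s m‖ ≤ 1) {w : ℂ}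
    (hw : Tendsto (fun m : ℕ => (m : ℂ) * (s m - 1)) atTop (𝓝 w)) (hw0 : w ≠ 0)
    (hbw : 1 - b * w ≠ 0) :
    Tendsto (fun m : ℕ => ∏ k ∈ Finset.range m, G (F^[k] (s m))) atTop
      (𝓝 (1 / (1 - b * w) ^ 2)) := by
  have hinv : Tendsto (fun m : ℕ => ((m : ℂ))⁻¹) atTop (𝓝 0) := tendsto_inv_atTop_nhds_zero_nat
  have hs1 : Tendsto (fun m => s m - 1) atTop (𝓝 0) := by
    have := hinv.mul hw
    rw [zero_mul] at this
    refine this.congr' ?_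
    filter_upwards [eventually_ge_atTop 1] with m hm
    have : (m : ℂ) ≠ 0 := by exact_mod_cast (by omega : m ≠ 0)
    field_simp
  have hs1n : Tendsto (fun m => ‖s m - 1‖) atTop (𝓝 0) := by simpa using hs1.norm
  have herr : Tendsto (fun m : ℕ => (m : ℝ) * ‖s m - 1‖ ^ 2) atTop (𝓝 0) := by
    have := hw.norm.mul hs1n
    rw [mul_zero] at this
    refine this.congr fun m => ?_
    rw [norm_mul, Complex.norm_natCast]
    ring
  have hne : ∀ᶠ m in atTop, s m ≠ 1 := by
    filter_upwards [hw.eventually_ne hw0] with m hm h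
    exact hm (by rw [h]; simp)
  have hsm : ∀ᶠ m in atTop, (b + M) * ‖s m - 1‖ ≤ 1 / 2 := by
    have := hs1n.const_mul (b + M)
    rw [mul_zero] at this
    exact this.eventually_le_const (by norm_num)
  have hsm' : ∀ᶠ m in atTop, ‖s m - 1‖ ≤ 1 := hs1n.eventually_le_const (by norm_num)
  -- the product is of the form `B m / A m ^ 2` with `A m → 1 - b * w` and `B m → 1`
  set A : ℕ → ℂ := fun m => (s m - 1) / (F^[m] (s m) - 1) with hA
  have hAlim : Tendsto A atTop (𝓝 (1 - b * w)) := by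
    have h1 : Tendsto (fun m => A m - (1 - b * (m * (s m - 1)))) atTop (𝓝 0) := by
      refine squeeze_zero_norm' (a := fun m : ℕ =>
        2 * (b * (b + M) + M) * (m * ‖s m - 1‖ ^ 2)) ?_ ?_
      · filter_upwards [hne, hsm, hsm'] with m h1 h2 h3
        exact (parabolic_iterate hb hM hF1 hF2 hF hG (hs m) h1 h2 h3 m).1
      · simpa using herr.const_mul (2 * (b * (b + M) + M))
    have h2 := h1.add ((hw.const_mul (b : ℂ)).const_sub 1)
    simpa using h2
  have hB : Tendsto (fun m : ℕ => (∏ k ∈ Finset.range m, G (F^[k] (s m))) * A m ^ 2) atTop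
      (𝓝 1) := by
    rw [tendsto_iff_norm_sub_tendsto_zero]
    refine squeeze_zero' (g := fun m : ℕ =>
      Real.exp (4 * (3 * M + (b + M) ^ 2) * (m * ‖s m - 1‖ ^ 2)) - 1)
      (Eventually.of_forall fun m => norm_nonneg _) ?_ ?_
    · filter_upwards [hne, hsm, hsm'] with m h1 h2 h3
      exact (parabolic_iterate hb hM hF1 hF2 hF hG (hs m) h1 h2 h3 m).2
    · have h1 := herr.const_mul (4 * (3 * M + (b + M) ^ 2))
      have h2 := ((Real.continuous_exp.tendsto _).comp h1).sub_const 1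
      simpa using h2
  refine (hB.div (hAlim.pow 2) (pow_ne_zero 2 hbw)).congr' ?_
  filter_upwards [hAlim.eventually_ne hbw] with m hm
  exact mul_div_cancel_right₀ _ (pow_ne_zero 2 hm)

end Iteration

/-! ### Expansion of the generating functions at `1` -/

section Expansion

theorem norm_pow_sub_one_le {s : ℂ} (hs : ‖s‖ ≤ 1) (k : ℕ) : ‖s ^ k - 1‖ ≤ k * ‖s - 1‖ := by
  induction k with
  | zero => simp
  | succ k ih =>
    have h1 : s ^ (k + 1) - 1 = (s ^ k - 1) + s ^ k * (s - 1) := by ring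
    have h2 : ‖s ^ k * (s - 1)‖ ≤ 1 * ‖s - 1‖ := by
      rw [norm_mul, norm_pow]
      exact mul_le_mul_of_nonneg_right (pow_le_one₀ (norm_nonneg _) hs) (norm_nonneg _)
    rw [h1]
    refine (norm_add_le _ _).trans ((add_le_add ih h2).trans (le_of_eq ?_))
    push_cast
    ring

theorem norm_pow_sub_linear_le {s : ℂ} (hs : ‖s‖ ≤ 1) (k : ℕ) :
    ‖s ^ k - 1 - k * (s - 1)‖ ≤ (k : ℝ) ^ 2 * ‖s - 1‖ ^ 2 := by
  induction k with
  | zero => simp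
  | succ k ih =>
    have h1 : s ^ (k + 1) - 1 - ((k + 1 : ℕ) : ℂ) * (s - 1) =
        (s ^ k - 1 - k * (s - 1)) + (s ^ k - 1) * (s - 1) := by
      push_cast
      ring
    have h2 : ‖(s ^ k - 1) * (s - 1)‖ ≤ k * ‖s - 1‖ * ‖s - 1‖ := by
      rw [norm_mul]
      exact mul_le_mul_of_nonneg_right (norm_pow_sub_one_le hs k) (norm_nonneg _)
    rw [h1]
    refine (norm_add_le _ _).trans ((add_le_add ih h2).trans ?_)
    push_cast
    have : 0 ≤ ((k : ℝ) + 1) * ‖s - 1‖ ^ 2 := by positivity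
    linarith [this]

theorem norm_pow_sub_quadratic_le {s : ℂ} (hs : ‖s‖ ≤ 1) (k : ℕ) :
    ‖s ^ k - 1 - k * (s - 1) - (k * (k - 1) / 2) * (s - 1) ^ 2‖ ≤ (k : ℝ) ^ 3 * ‖s - 1‖ ^ 3 := by
  induction k with
  | zero => simp
  | succ k ih =>
    have h1 : s ^ (k + 1) - 1 - ((k + 1 : ℕ) : ℂ) * (s - 1) -
          (((k + 1 : ℕ) : ℂ) * (((k + 1 : ℕ) : ℂ) - 1) / 2) * (s - 1) ^ 2 =
        (s ^ k - 1 - k * (s - 1) - (k * (k - 1) / 2) * (s - 1) ^ 2) +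
          (s ^ k - 1 - k * (s - 1)) * (s - 1) := by
      push_cast
      ring
    have h2 : ‖(s ^ k - 1 - k * (s - 1)) * (s - 1)‖ ≤ (k : ℝ) ^ 2 * ‖s - 1‖ ^ 2 * ‖s - 1‖ := by
      rw [norm_mul]
      exact mul_le_mul_of_nonneg_right (norm_pow_sub_linear_le hs k) (norm_nonneg _)
    rw [h1]
    refine (norm_add_le _ _).trans ((add_le_add ih h2).trans ?_)
    push_cast
    have : 0 ≤ (2 * (k : ℝ) ^ 2 + 3 * k + 1) * ‖s - 1‖ ^ 3 := by positivity
    linarith [this]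

variable (p : PMF ℕ) (hcrit : ∑' m : ℕ, (m : ℝ≥0∞) * p m = 1)

/-- The number of siblings of a spine vertex has the size-biased offspring law, less one. -/
theorem lintegral_siblingPMF (h : ℕ → ℝ≥0∞) :
    ∫⁻ x, h (x.1 + x.2) ∂(siblingPMF p hcrit).toMeasure =
      ∫⁻ k, (k : ℝ≥0∞) * h (k - 1) ∂p.toMeasure := by
  rw [lintegral_countable', lintegral_countable',
    ← Finset.HasAntidiagonal.sigmaAntidiagonalEquivProd.tsum_eq, ENNReal.tsum_sigma',
    tsum_eq_zero_add' (f := fun k : ℕ => (k : ℝ≥0∞) * h (k - 1) * p.toMeasure {k})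
      ENNReal.summable, Nat.cast_zero, zero_mul, zero_mul, zero_add]
  refine tsum_congr fun n => ?_
  rw [tsum_fintype, Finset.sum_congr rfl (g := fun _ => h n * p (n + 1)) fun x _ => ?_]
  · rw [PMF.toMeasure_apply_singleton _ _ (measurableSet_singleton _)]
    simp [mul_assoc]
  · have := Finset.HasAntidiagonal.mem_antidiagonal.1 x.2
    rw [PMF.toMeasure_apply_singleton _ _ (measurableSet_singleton _), siblingPMF_apply]
    simp only [Finset.HasAntidiagonal.sigmaAntidiagonalEquivProd_apply]
    rw [this]

variable {p}

theorem integrable_cube (hthird : ∑' m : ℕ, (m : ℝ≥0∞) ^ 3 * p m ≠ ∞) :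
    Integrable (fun k : ℕ => (k : ℝ) ^ 3) p.toMeasure := by
  have h := (integrable_toReal_iff (μ := p.toMeasure) (f := fun k : ℕ => (k : ℝ≥0∞) ^ 3)
    Measurable.of_discrete.aemeasurable (ae_of_all _ fun k => by simp)).2 ?_
  · simpa using h
  · rw [lintegral_countable']
    simpa [PMF.toMeasure_apply_singleton] using hthird

/-- A function of at most cubic growth is integrable if the third moment is finite. -/
theorem integrable_of_le_cube {𝕜 : Type*} [RCLike 𝕜]
    (hthird : ∑' m : ℕ, (m : ℝ≥0∞) ^ 3 * p m ≠ ∞) {f : ℕ → 𝕜} {c : ℝ}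
    (hf : ∀ k, ‖f k‖ ≤ c * (1 + (k : ℝ) ^ 3)) : Integrable f p.toMeasure := by
  refine (((integrable_const 1).add (integrable_cube hthird)).const_mul c).mono'
    Measurable.of_discrete.aestronglyMeasurable (ae_of_all _ hf)

theorem integral_natCast_eq_one (hcrit : ∑' m : ℕ, (m : ℝ≥0∞) * p m = 1) :
    ∫ k : ℕ, (k : ℝ) ∂p.toMeasure = 1 := by
  rw [integral_eq_lintegral_of_nonneg_ae (ae_of_all _ fun k => by positivity)
    Measurable.of_discrete.aestronglyMeasurable, lintegral_countable']
  simp only [ENNReal.ofReal_natCast, PMF.toMeasure_apply_singleton _ _ (measurableSet_singleton _)]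
  rw [hcrit, ENNReal.toReal_one]

theorem natCast_pow_le_one_add_cube (k : ℕ) {j : ℕ} (hj : j ≤ 3) :
    (k : ℝ) ^ j ≤ 1 * (1 + (k : ℝ) ^ 3) := by
  rcases k.eq_zero_or_pos with rfl | hk
  · rcases j.eq_zero_or_pos with rfl | hj'
    · simp
    · simp [hj'.ne']
  · have h1 : (1 : ℝ) ≤ k := by exact_mod_cast hk
    have := pow_le_pow_right₀ h1 hj
    linarith

theorem integrable_natCast_pow (hthird : ∑' m : ℕ, (m : ℝ≥0∞) ^ 3 * p m ≠ ∞) {j : ℕ}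
    (hj : j ≤ 3) : Integrable (fun k : ℕ => (k : ℝ) ^ j) p.toMeasure := by
  refine integrable_of_le_cube hthird (c := 1) fun k => ?_
  rw [Real.norm_of_nonneg (by positivity)]
  exact natCast_pow_le_one_add_cube k hj

theorem integrable_mul_sub_one (hthird : ∑' m : ℕ, (m : ℝ≥0∞) ^ 3 * p m ≠ ∞) :
    Integrable (fun k : ℕ => (k : ℝ) * ((k : ℝ) - 1)) p.toMeasure := by
  refine ((integrable_natCast_pow hthird (j := 2) (by norm_num)).sub
    (integrable_natCast_pow hthird (j := 1) (by norm_num))).congr (ae_of_all _ fun k => ?_)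
  simp only [Pi.sub_apply]
  ring

theorem integral_mul_sub_one (hthird : ∑' m : ℕ, (m : ℝ≥0∞) ^ 3 * p m ≠ ∞) :
    ∫ k : ℕ, (k : ℝ) * ((k : ℝ) - 1) ∂p.toMeasure = offspringVar p := by
  rw [PMF.integral_eq_tsum _ _ (integrable_mul_sub_one hthird), offspringVar]
  simp only [smul_eq_mul, mul_comm]

theorem integral_siblingPMF {h : ℕ → ℝ} (hh : ∀ k, 0 ≤ h k) :
    ∫ x, h (x.1 + x.2) ∂(siblingPMF p hcrit).toMeasure =
      ∫ k : ℕ, (k : ℝ) * h (k - 1) ∂p.toMeasure := by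
  rw [integral_eq_lintegral_of_nonneg_ae (ae_of_all _ fun x => hh _)
      Measurable.of_discrete.aestronglyMeasurable,
    integral_eq_lintegral_of_nonneg_ae (ae_of_all _ fun k => mul_nonneg k.cast_nonneg (hh _))
      Measurable.of_discrete.aestronglyMeasurable,
    lintegral_siblingPMF p hcrit fun n => ENNReal.ofReal (h n)]
  simp only [ENNReal.ofReal_mul (Nat.cast_nonneg _), ENNReal.ofReal_natCast]

theorem integrable_siblingPMF {h : ℕ → ℝ} (hh : ∀ k, 0 ≤ h k)
    (hi : Integrable (fun k : ℕ => (k : ℝ) * h (k - 1)) p.toMeasure) :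
    Integrable (fun x => h (x.1 + x.2)) (siblingPMF p hcrit).toMeasure := by
  refine ⟨Measurable.of_discrete.aestronglyMeasurable, ?_⟩
  rw [hasFiniteIntegral_iff_ofReal (ae_of_all _ fun x => hh _),
    lintegral_siblingPMF p hcrit fun n => ENNReal.ofReal (h n)]
  have := hi.2
  rw [hasFiniteIntegral_iff_ofReal
    (ae_of_all _ fun k => mul_nonneg k.cast_nonneg (hh _))] at this
  simpa only [ENNReal.ofReal_mul (Nat.cast_nonneg _), ENNReal.ofReal_natCast] using this

theorem integrable_pow {α : Type*} [MeasurableSpace α] [DiscreteMeasurableSpace α]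
    (μ : Measure α) [IsFiniteMeasure μ] (f : α → ℕ) {s : ℂ} (hs : ‖s‖ ≤ 1) :
    Integrable (fun x => s ^ f x) μ := by
  refine Integrable.of_bound Measurable.of_discrete.aestronglyMeasurable 1 (ae_of_all _ fun x => ?_)
  rw [norm_pow]
  exact pow_le_one₀ (norm_nonneg _) hs

theorem norm_pgf_sub_one_le (hcrit : ∑' m : ℕ, (m : ℝ≥0∞) * p m = 1)
    (hthird : ∑' m : ℕ, (m : ℝ≥0∞) ^ 3 * p m ≠ ∞) {s : ℂ} (hs : ‖s‖ ≤ 1) :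
    ‖pgf p s - 1‖ ≤ ‖s - 1‖ := by
  have hs' := integrable_pow p.toMeasure (fun k : ℕ => k) hs
  have h1 : pgf p s - 1 = ∫ k : ℕ, (s ^ k - 1) ∂p.toMeasure := by
    rw [integral_sub hs' (integrable_const _)]
    simp [pgf]
  have hk : Integrable (fun k : ℕ => (k : ℝ)) p.toMeasure := by
    simpa using integrable_natCast_pow hthird (j := 1) (by norm_num)
  rw [h1]
  refine (norm_integral_le_of_norm_le (hk.mul_const ‖s - 1‖)
    (ae_of_all _ fun k => norm_pow_sub_one_le hs k)).trans (le_of_eq ?_)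
  rw [integral_mul_const, integral_natCast_eq_one hcrit, one_mul]

theorem norm_pgf_sub_quadratic_le (hcrit : ∑' m : ℕ, (m : ℝ≥0∞) * p m = 1)
    (hthird : ∑' m : ℕ, (m : ℝ≥0∞) ^ 3 * p m ≠ ∞) {s : ℂ} (hs : ‖s‖ ≤ 1) :
    ‖(pgf p s - 1) - (s - 1) - ((offspringVar p / 2 : ℝ) : ℂ) * (s - 1) ^ 2‖ ≤
      (∫ k : ℕ, (k : ℝ) ^ 3 ∂p.toMeasure) * ‖s - 1‖ ^ 3 := by
  have hs' := integrable_pow p.toMeasure (fun k : ℕ => k) hs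
  have hk : Integrable (fun k : ℕ => (k : ℝ)) p.toMeasure := by
    simpa using integrable_natCast_pow hthird (j := 1) (by norm_num)
  have i1 : Integrable (fun k : ℕ => (k : ℂ) * (s - 1)) p.toMeasure := by
    simpa using (hk.ofReal (𝕜 := ℂ)).mul_const (s - 1)
  have i2 : Integrable (fun k : ℕ => ((k : ℂ) * (k - 1) / 2) * (s - 1) ^ 2) p.toMeasure := by
    have := ((integrable_mul_sub_one hthird).ofReal (𝕜 := ℂ)).mul_const ((s - 1) ^ 2 / 2)
    refine this.congr (ae_of_all _ fun k => ?_)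
    simp only [Complex.coe_algebraMap]
    push_cast
    ring
  have e1 : ∫ k : ℕ, (k : ℂ) * (s - 1) ∂p.toMeasure = s - 1 := by
    have : ∫ k : ℕ, (k : ℂ) ∂p.toMeasure = 1 := by
      rw [← Complex.ofReal_one, ← integral_natCast_eq_one hcrit, ← integral_complex_ofReal]
      simp
    rw [integral_mul_const, this, one_mul]
  have e2 : ∫ k : ℕ, ((k : ℂ) * (k - 1) / 2) * (s - 1) ^ 2 ∂p.toMeasure =
      ((offspringVar p / 2 : ℝ) : ℂ) * (s - 1) ^ 2 := by
    have : ∫ k : ℕ, (k : ℂ) * (k - 1) / 2 ∂p.toMeasure = ((offspringVar p / 2 : ℝ) : ℂ) := by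
      rw [← integral_mul_sub_one hthird, ← integral_div, ← integral_complex_ofReal]
      simp
    rw [integral_mul_const, this]
  have h1 : (pgf p s - 1) - (s - 1) - ((offspringVar p / 2 : ℝ) : ℂ) * (s - 1) ^ 2 =
      ∫ k : ℕ, (s ^ k - 1 - k * (s - 1) - (k * (k - 1) / 2) * (s - 1) ^ 2) ∂p.toMeasure := by
    have i0 : Integrable (fun k : ℕ => s ^ k - 1) p.toMeasure := hs'.sub (integrable_const _)
    have i01 : Integrable (fun k : ℕ => s ^ k - 1 - k * (s - 1)) p.toMeasure := i0.sub i1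
    rw [integral_sub i01 i2, integral_sub i0 i1, integral_sub hs' (integrable_const _), e1, e2]
    simp [pgf]
  rw [h1]
  refine (norm_integral_le_of_norm_le ((integrable_cube hthird).mul_const (‖s - 1‖ ^ 3))
    (ae_of_all _ fun k => norm_pow_sub_quadratic_le hs k)).trans (le_of_eq ?_)
  rw [integral_mul_const]

theorem norm_siblingPgf_sub_linear_le (hthird : ∑' m : ℕ, (m : ℝ≥0∞) ^ 3 * p m ≠ ∞) {s : ℂ}
    (hs : ‖s‖ ≤ 1) :
    ‖siblingPgf p hcrit s - 1 - 2 * ((offspringVar p / 2 : ℝ) : ℂ) * (s - 1)‖ ≤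
      (∫ k : ℕ, (k : ℝ) ^ 3 ∂p.toMeasure) * ‖s - 1‖ ^ 2 := by
  have hpred : ∀ k : ℕ, (k : ℝ) * ((k - 1 : ℕ) : ℝ) = (k : ℝ) * ((k : ℝ) - 1) := by
    intro k
    rcases k.eq_zero_or_pos with rfl | hk
    · simp
    · rw [Nat.cast_pred hk]
  have hsq : ∀ k : ℕ, (k : ℝ) * ((k - 1 : ℕ) : ℝ) ^ 2 ≤ (k : ℝ) ^ 3 := by
    intro k
    have h1 : ((k - 1 : ℕ) : ℝ) ≤ k := by exact_mod_cast Nat.sub_le k 1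
    calc (k : ℝ) * ((k - 1 : ℕ) : ℝ) ^ 2 ≤ (k : ℝ) * (k : ℝ) ^ 2 := by gcongr
      _ = (k : ℝ) ^ 3 := by ring
  have hk2 : Integrable (fun k : ℕ => (k : ℝ) * ((k - 1 : ℕ) : ℝ) ^ 2) p.toMeasure := by
    refine (integrable_cube hthird).mono' Measurable.of_discrete.aestronglyMeasurable
      (ae_of_all _ fun k => ?_)
    rw [Real.norm_of_nonneg (by positivity)]
    exact hsq k
  have hs' := integrable_pow (siblingPMF p hcrit).toMeasure (fun x => x.1 + x.2) hs
  have hq1 : Integrable (fun x : ℕ × ℕ => ((x.1 + x.2 : ℕ) : ℝ))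
      (siblingPMF p hcrit).toMeasure := by
    refine integrable_siblingPMF hcrit (h := fun k => (k : ℝ)) (fun k => k.cast_nonneg) ?_
    simp only [hpred]
    exact integrable_mul_sub_one hthird
  have hq2 : Integrable (fun x : ℕ × ℕ => ((x.1 + x.2 : ℕ) : ℝ) ^ 2)
      (siblingPMF p hcrit).toMeasure :=
    integrable_siblingPMF hcrit (h := fun k => (k : ℝ) ^ 2) (fun k => by positivity) hk2
  have i1 : Integrable (fun x : ℕ × ℕ => ((x.1 + x.2 : ℕ) : ℂ) * (s - 1))
      (siblingPMF p hcrit).toMeasure := by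
    refine ((hq1.ofReal (𝕜 := ℂ)).mul_const (s - 1)).congr (ae_of_all _ fun x => ?_)
    simp
  have e1 : ∫ x, ((x.1 + x.2 : ℕ) : ℂ) * (s - 1) ∂(siblingPMF p hcrit).toMeasure =
      2 * ((offspringVar p / 2 : ℝ) : ℂ) * (s - 1) := by
    have h1 := integral_siblingPMF hcrit (h := fun k => (k : ℝ)) (fun k => k.cast_nonneg)
    simp only [hpred] at h1
    have : ∫ x, ((x.1 + x.2 : ℕ) : ℂ) ∂(siblingPMF p hcrit).toMeasure = (offspringVar p : ℂ) := by
      rw [← integral_mul_sub_one hthird, ← h1, ← integral_complex_ofReal]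
      simp
    rw [integral_mul_const, this]
    push_cast
    ring
  have h1 : siblingPgf p hcrit s - 1 - 2 * ((offspringVar p / 2 : ℝ) : ℂ) * (s - 1) =
      ∫ x, (s ^ (x.1 + x.2) - 1 - ((x.1 + x.2 : ℕ) : ℂ) * (s - 1))
        ∂(siblingPMF p hcrit).toMeasure := by
    have i0 : Integrable (fun x : ℕ × ℕ => s ^ (x.1 + x.2) - 1) (siblingPMF p hcrit).toMeasure :=
      hs'.sub (integrable_const _)
    rw [integral_sub i0 i1, integral_sub hs' (integrable_const _), e1]
    simp [siblingPgf]
  rw [h1]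
  refine (norm_integral_le_of_norm_le (hq2.mul_const (‖s - 1‖ ^ 2))
    (ae_of_all _ fun x => norm_pow_sub_linear_le hs (x.1 + x.2))).trans ?_
  rw [integral_mul_const,
    integral_siblingPMF hcrit (h := fun k => (k : ℝ) ^ 2) (fun k => by positivity)]
  exact mul_le_mul_of_nonneg_right (integral_mono hk2 (integrable_cube hthird) hsq) (by positivity)

end Expansion

/-! ### Characteristic functions and the limit law -/

section LimitLaw

theorem integral_mul_exp_neg_mul_Ioi {a : ℝ} (ha : 0 < a) {c : ℂ} (hc : c.re = a) :
    ∫ x : ℝ in Set.Ioi 0, (x : ℂ) * Complex.exp (-(c * x)) = 1 / c ^ 2 := by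
  have hc0 : c ≠ 0 := by
    rintro rfl
    simp at hc
    exact ha.ne hc
  have hnorm : ∀ x : ℝ, ‖Complex.exp (-(c * x))‖ = Real.exp (-a * x) := by
    intro x
    rw [Complex.norm_exp]
    simp [hc]
  -- an antiderivative, found by integration by parts
  have hderiv : ∀ x : ℝ, HasDerivAt
      (fun x : ℝ => -((x : ℂ) / c + 1 / c ^ 2) * Complex.exp (-(c * x)))
      ((x : ℂ) * Complex.exp (-(c * x))) x := by
    intro x
    have h1 : HasDerivAt (fun x : ℝ => (x : ℂ)) 1 x := Complex.ofRealCLM.hasDerivAt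
    have h2 := ((h1.div_const c).add_const (1 / c ^ 2)).neg.mul ((h1.const_mul c).neg.cexp)
    refine h2.congr_deriv ?_
    simp only [Pi.neg_apply]
    field_simp
    ring
  have hint : IntegrableOn (fun x : ℝ => (x : ℂ) * Complex.exp (-(c * x))) (Set.Ioi 0) := by
    have h := integrableOn_rpow_mul_exp_neg_mul_rpow (p := 1) (s := 1) (b := a) (by norm_num)
      one_pos ha
    refine h.mono' (by fun_prop) ?_
    filter_upwards [ae_restrict_mem measurableSet_Ioi] with x hx
    rw [norm_mul, hnorm, Complex.norm_real, Real.norm_of_nonneg (le_of_lt hx)]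
    simp
  have hlim : Tendsto (fun x : ℝ => -((x : ℂ) / c + 1 / c ^ 2) * Complex.exp (-(c * x))) atTop
      (𝓝 0) := by
    have h0 := tendsto_rpow_mul_exp_neg_mul_atTop_nhds_zero 0 a ha
    have h1 := tendsto_rpow_mul_exp_neg_mul_atTop_nhds_zero 1 a ha
    have h2 := (h1.mul_const (1 / ‖c‖)).add (h0.mul_const (1 / ‖c‖ ^ 2))
    rw [zero_mul, zero_mul, add_zero] at h2
    refine squeeze_zero_norm' ?_ h2
    filter_upwards [eventually_ge_atTop 0] with x hx
    rw [norm_mul, hnorm, norm_neg]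
    have h3 : ‖(x : ℂ) / c + 1 / c ^ 2‖ ≤ x / ‖c‖ + 1 / ‖c‖ ^ 2 := by
      refine (norm_add_le _ _).trans (le_of_eq ?_)
      rw [norm_div, norm_div, norm_pow, norm_one, Complex.norm_real, Real.norm_of_nonneg hx]
    refine (mul_le_mul_of_nonneg_right h3 (Real.exp_pos _).le).trans (le_of_eq ?_)
    rw [Real.rpow_one, Real.rpow_zero]
    ring
  rw [integral_Ioi_of_hasDerivAt_of_tendsto (hderiv 0).continuousAt.continuousWithinAt
    (fun x _ => hderiv x) hint hlim]
  simp

theorem charFun_sizeBiasedExp {a : ℝ} (ha : 0 < a) (θ : ℝ) :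
    charFun (sizeBiasedExp a ha : Measure ℝ) θ = 1 / (1 - (1 / a : ℝ) * (θ * Complex.I)) ^ 2 := by
  have hmeas : Measurable fun x => ENNReal.ofReal (sizeBiasedExpDensity a x) := by
    unfold sizeBiasedExpDensity
    exact (Measurable.ite measurableSet_Ici (by fun_prop) measurable_const).ennreal_ofReal
  rw [charFun_apply_real]
  change ∫ x : ℝ, _ ∂(volume : Measure ℝ).withDensity
    (fun x => ENNReal.ofReal (sizeBiasedExpDensity a x)) = _
  rw [integral_withDensity_eq_integral_toReal_smul hmeas
    (ae_of_all _ fun x => ENNReal.ofReal_lt_top)]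
  have h1 : ∀ x : ℝ, (ENNReal.ofReal (sizeBiasedExpDensity a x)).toReal •
      Complex.exp (θ * x * Complex.I) = (Set.Ioi (0 : ℝ)).indicator
        (fun x => (a : ℂ) ^ 2 * ((x : ℂ) * Complex.exp (-((a - θ * Complex.I) * x)))) x := by
    intro x
    by_cases hx : 0 < x
    · rw [Set.indicator_of_mem (by exact hx), sizeBiasedExpDensity, if_pos hx.le,
        ENNReal.toReal_ofReal (by positivity), Complex.real_smul]
      have : -(((a : ℂ) - θ * Complex.I) * x) = -(a * x) + θ * x * Complex.I := by ring
      rw [this, Complex.exp_add]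
      push_cast
      ring
    · rw [Set.indicator_of_notMem (by exact hx)]
      have : sizeBiasedExpDensity a x = 0 := by
        unfold sizeBiasedExpDensity
        split_ifs with h
        · rw [le_antisymm (not_lt.1 hx) h]
          simp
        · rfl
      simp [this]
  simp_rw [h1]
  have hre : ((a : ℂ) - θ * Complex.I).re = a := by simp
  have hc0 : (a : ℂ) - θ * Complex.I ≠ 0 := by
    intro h
    rw [h] at hre
    simp at hre
    exact ha.ne hre
  rw [integral_indicator measurableSet_Ioi, integral_const_mul,
    integral_mul_exp_neg_mul_Ioi ha hre]
  have ha0 : (a : ℂ) ≠ 0 := by exact_mod_cast ha.ne'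
  have h2 : 1 - ((1 / a : ℝ) : ℂ) * (θ * Complex.I) = (a - θ * Complex.I) / a := by
    push_cast
    field_simp
  rw [h2]
  field_simp

theorem tendsto_mul_exp_div_sub_one (z : ℂ) :
    Tendsto (fun m : ℕ => (m : ℂ) * (Complex.exp (z / m) - 1)) atTop (𝓝 z) := by
  have hd : HasDerivAt (fun t : ℂ => Complex.exp (z * t)) z 0 := by
    simpa using ((hasDerivAt_id (0 : ℂ)).const_mul z).cexp
  have hinv : Tendsto (fun m : ℕ => ((m : ℂ))⁻¹) atTop (𝓝[≠] 0) := by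
    refine tendsto_nhdsWithin_iff.2 ⟨tendsto_inv_atTop_nhds_zero_nat, ?_⟩
    filter_upwards [eventually_ge_atTop 1] with m hm
    exact inv_ne_zero (by exact_mod_cast (by omega : m ≠ 0))
  refine (hd.tendsto_slope_zero.comp hinv).congr fun m => ?_
  simp [div_eq_mul_inv]

variable {d : ℕ} (p : PMF ℕ) (hcrit : ∑' m : ℕ, (m : ℝ≥0∞) * p m = 1) (D : PMF (ZdPoint d))

theorem measurable_N_div (m : ℕ) : Measurable fun T : EmbTree d => (T.N m : ℝ) / (m : ℝ) :=
  (Measurable.of_discrete (f := fun k : ℕ => (k : ℝ) / (m : ℝ))).comp (EmbTree.measurable_N m)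

theorem charFun_iibrw_N_div (m : ℕ) (θ : ℝ) :
    charFun ((iibrw p hcrit D : Measure (EmbTree d)).map fun T => (T.N m : ℝ) / (m : ℝ)) θ =
      Complex.exp (θ * Complex.I / m) *
        levelPgf p hcrit D m (Complex.exp (θ * Complex.I / m)) := by
  rw [charFun_apply_real, integral_map (measurable_N_div m).aemeasurable (by fun_prop)]
  change ∫ T : EmbTree d, _ ∂(spineLaw p hcrit D).map spineTree = _
  have hmeas : Measurable fun T : EmbTree d =>
      Complex.exp (θ * ((T.N m : ℝ) / (m : ℝ) : ℝ) * Complex.I) :=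
    Complex.measurable_exp.comp
      (((Complex.measurable_ofReal.comp (measurable_N_div m)).const_mul _).mul_const _)
  rw [integral_map measurable_spineTree.aemeasurable hmeas.aestronglyMeasurable, levelPgf,
    ← integral_const_mul]
  refine integral_congr_ae (ae_of_all _ fun ω => ?_)
  simp only
  rw [← pow_succ', Nat.sub_add_cancel (N_spineTree_pos ω m), ← Complex.exp_nat_mul]
  congr 1
  push_cast
  ring

theorem tendsto_charFun_iibrw (hthird : ∑' m : ℕ, (m : ℝ≥0∞) ^ 3 * p m ≠ ∞)
    (hσ : 0 < offspringVar p) (θ : ℝ) :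
    Tendsto (fun m : ℕ => charFun
        ((iibrw p hcrit D : Measure (EmbTree d)).map fun T => (T.N m : ℝ) / (m : ℝ)) θ) atTop
      (𝓝 (charFun (sizeBiasedExp (2 / offspringVar p) (div_pos two_pos hσ) : Measure ℝ) θ)) := by
  -- at `θ = 0` the iteration would start at the fixed point `1` itself
  rcases eq_or_ne θ 0 with rfl | hθ
  · have : ∀ m : ℕ, IsProbabilityMeasure
        ((iibrw p hcrit D : Measure (EmbTree d)).map fun T => (T.N m : ℝ) / (m : ℝ)) :=
      fun m => Measure.isProbabilityMeasure_map (measurable_N_div m).aemeasurable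
    simp
  set s : ℕ → ℂ := fun m => Complex.exp (θ * Complex.I / m) with hs
  have hs1 : ∀ m, ‖s m‖ ≤ 1 := by
    intro m
    rw [hs, Complex.norm_exp]
    simp
  have hslim : Tendsto s atTop (𝓝 1) := by
    have h := (tendsto_inv_atTop_nhds_zero_nat (𝕜 := ℂ)).const_mul (θ * Complex.I)
    rw [mul_zero] at h
    have h2 := (Complex.continuous_exp.tendsto 0).comp h
    rw [Complex.exp_zero] at h2
    exact h2
  have hw0 : (θ : ℂ) * Complex.I ≠ 0 :=
    mul_ne_zero (by exact_mod_cast hθ) Complex.I_ne_zero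
  have hbw : 1 - ((offspringVar p / 2 : ℝ) : ℂ) * (θ * Complex.I) ≠ 0 := by
    intro h
    have := congrArg Complex.re h
    simp at this
  have hprod := tendsto_prod_parabolic (F := pgf p) (G := siblingPgf p hcrit)
    (b := offspringVar p / 2) (M := ∫ k : ℕ, (k : ℝ) ^ 3 ∂p.toMeasure) (by positivity)
    (integral_nonneg fun k => by positivity) (fun s hs => norm_pgf_le_one p hs)
    (fun s hs => norm_pgf_sub_one_le hcrit hthird hs)
    (fun s hs => norm_pgf_sub_quadratic_le hcrit hthird hs)
    (fun s hs => norm_siblingPgf_sub_linear_le hcrit hthird hs) hs1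
    (tendsto_mul_exp_div_sub_one (θ * Complex.I)) hw0 hbw
  rw [charFun_sizeBiasedExp, one_div_div]
  have h := hslim.mul hprod
  rw [one_mul] at h
  refine h.congr fun m => ?_
  rw [charFun_iibrw_N_div, levelPgf_eq_prod p hcrit D m (hs1 m)]

end LimitLaw

theorem mainTheorem9 {d : ℕ} (p : PMF ℕ) (D : PMF (ZdPoint d))
    (hcrit : ∑' m : ℕ, (m : ℝ≥0∞) * p m = 1)
    (hthird : ∑' m : ℕ, (m : ℝ≥0∞) ^ 3 * p m ≠ ∞)
    (hσ : 0 < offspringVar p) :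
    (∃! P : ProbabilityMeasure (EmbTree d), IsIIBRW p D P) ∧
    ∀ P : ProbabilityMeasure (EmbTree d), IsIIBRW p D P →
      TendstoInDistribution (fun (m : ℕ) (T : EmbTree d) => (T.N m : ℝ) / (m : ℝ)) atTop
        (fun x : ℝ => x) (fun _ => (P : Measure (EmbTree d)))
        (sizeBiasedExp (2 / offspringVar p) (div_pos two_pos hσ) : Measure ℝ) := by
  refine ⟨⟨iibrw p hcrit D, isIIBRW_iibrw p hcrit D, fun P hP => hP.eq_iibrw hcrit⟩, ?_⟩
  intro P hP
  obtain rfl := hP.eq_iibrw hcrit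
  refine ⟨fun m => (measurable_N_div m).aemeasurable, measurable_id.aemeasurable, ?_⟩
  refine ProbabilityMeasure.tendsto_iff_tendsto_charFun.2 fun θ => ?_
  have h := tendsto_charFun_iibrw p hcrit D hthird hσ θ
  rw [← Measure.map_id (μ := (sizeBiasedExp (2 / offspringVar p) (div_pos two_pos hσ) :
    Measure ℝ))] at h
  exact h
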